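/- Let $\epsilon\in\{-1,1\}$ and $n\ge 0$. An \emph{$\epsilon$-Kähler manifold} $(M,J,g)$ is a smooth (Hausdorff) manifold with a pseudo-Riemannian metric $g$ and a smooth, $g$-skew-symmetric endomorphism field $J$ of $TM$ with $J^2=\epsilon\,\mathrm{Id}$ which is parallel for the Levi-Civita connection $D$ of $g$; put $\omega=\epsilon g(J\cdot,\cdot)$. A \emph{conical affine special $\epsilon$-Kähler manifold} $(M,J,g,\nabla,\xi)$ is an $\epsilon$-Kähler manifold with a flat torsion-free connection $\nabla$ such that $\nabla\omega=0$ and $(\nabla_XJ)Y=(\nabla_YJ)X$ for all $X,Y$, and with a smooth vector field $\xi$ such that $\nabla\xi=D\xi=\mathrm{Id}$. Let $\dim_{\mathbb R}M=2n+2$, let $\mathcal D=\mathrm{span}\{\xi,J\xi\}$, and let $\pi:M\to\bar M$ be the canonical map onto the space of leaves of $\mathcal D$, with the quotient topology. Suppose that $(M,J,g,\nabla,\xi)$ is \emph{regular}: the function $g(\xi,\xi)$ has no zeros on $M$, and $\bar M$ is a Hausdorff smooth manifold of real dimension $2n$ with an $\epsilon$-complex (i.e. complex if $\epsilon=-1$,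 para-complex if $\epsilon=1$) structure $\bar J$, for which $\pi$ is a holomorphic submersion, i.e. a smooth submersion with $d\pi\circ J=\bar J\circ d\pi$. \textbf{Proposition.} The $(0,2)$-tensor field $$h=\frac{g}{g(\xi,\xi)}-\frac{g(\cdot,\xi)\otimes g(\cdot,\xi)-\epsilon\,g(\cdot,J\xi)\otimes g(\cdot,J\xi)}{g(\xi,\xi)^2}$$ on $M$ descends to $\bar M$: there is a unique $(0,2)$-tensor field $\bar g$ on $\bar M$ with $\pi^*\bar g=h$, and $(\bar M,\bar J,\bar g)$ is an $\epsilon$-Kähler manifold. (The manifold $(\bar M,\bar J,\bar g)$ is called a projective special $\epsilon$-Kähler manifold.) -/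

import Mathlib

open scoped Manifold ContDiff Bundle

noncomputable section

namespace EpsKahler

section Tensors

variable {E : Type*} [NormedAddCommGroup E] [NormedSpace ℝ E]
  {M : Type*} [TopologicalSpace M] [ChartedSpace E M]

/-- Vector fields on a manifold `M` modelled on `E`. -/
abbrev VField (E : Type*) [NormedAddCommGroup E] [NormedSpace ℝ E]
    (M : Type*) [TopologicalSpace M] [ChartedSpace E M] : Type _ :=
  Π x : M, TangentSpace 𝓘(ℝ, E) x

/-- Fields of endomorphisms of the tangent spaces, i.e. (1,1)-tensor fields. -/
abbrev EndField (E : Type*) [NormedAddCommGroup E] [NormedSpace ℝ E]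
    (M : Type*) [TopologicalSpace M] [ChartedSpace E M] : Type _ :=
  Π x : M, TangentSpace 𝓘(ℝ, E) x →L[ℝ] TangentSpace 𝓘(ℝ, E) x

/-- Fields of bilinear forms on the tangent spaces, i.e. (0,2)-tensor fields. -/
abbrev BilinField (E : Type*) [NormedAddCommGroup E] [NormedSpace ℝ E]
    (M : Type*) [TopologicalSpace M] [ChartedSpace E M] : Type _ :=
  Π x : M, TangentSpace 𝓘(ℝ, E) x →L[ℝ] TangentSpace 𝓘(ℝ, E) x →L[ℝ] ℝ

/-- Koszul connections on the tangent bundle. Note the argument order: `D Y x v` is `(D_v Y)(x)`. -/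
abbrev Connection (E : Type*) [NormedAddCommGroup E] [NormedSpace ℝ E]
    (M : Type*) [TopologicalSpace M] [ChartedSpace E M] [IsManifold 𝓘(ℝ, E) ∞ M] : Type _ :=
  CovariantDerivative 𝓘(ℝ, E) E (TangentSpace 𝓘(ℝ, E) : M → Type _)

/-- The 2-form `ω = ε g(J·, ·)`. -/
def kahlerForm (ε : ℝ) (g : BilinField E M) (J : EndField E M) : BilinField E M :=
  fun x ↦ ε • (g x).comp (J x)

theorem kahlerForm_apply (ε : ℝ) (g : BilinField E M) (J : EndField E M) (x : M)
    (v w : TangentSpace 𝓘(ℝ, E) x) : kahlerForm ε g J x v w = ε * g x (J x v) w := rfl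

/-- The 1-form `g(·, ξ)`. -/
def rightContract (g : BilinField E M) (ξ : VField E M) (x : M) :
    TangentSpace 𝓘(ℝ, E) x →L[ℝ] ℝ where
  toFun v := g x v (ξ x)
  map_add' v w := by simp
  map_smul' c v := by simp
  cont := (continuous_eval_const (ξ x)).comp (g x).continuous

/-- The tensor
`h = g / g(ξ,ξ) - (g(·,ξ) ⊗ g(·,ξ) - ε g(·,Jξ) ⊗ g(·,Jξ)) / g(ξ,ξ)²`. -/
def hTensor (ε : ℝ) (J : EndField E M) (g : BilinField E M) (ξ : VField E M) :
    BilinField E M := fun x ↦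
  (g x (ξ x) (ξ x))⁻¹ • g x
    - (g x (ξ x) (ξ x) ^ 2)⁻¹ •
      ((rightContract g ξ x).smulRight (rightContract g ξ x)
        - ε • (rightContract g (fun y ↦ J y (ξ y)) x).smulRight
          (rightContract g (fun y ↦ J y (ξ y)) x))

theorem hTensor_apply (ε : ℝ) (J : EndField E M) (g : BilinField E M) (ξ : VField E M) (x : M)
    (v w : TangentSpace 𝓘(ℝ, E) x) :
    hTensor ε J g ξ x v w =
      g x v w / g x (ξ x) (ξ x)
        - (g x v (ξ x) * g x w (ξ x) - ε * (g x v (J x (ξ x)) * g x w (J x (ξ x))))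
          / g x (ξ x) (ξ x) ^ 2 := by
  change (g x (ξ x) (ξ x))⁻¹ * g x v w - (g x (ξ x) (ξ x) ^ 2)⁻¹ *
    (g x v (ξ x) * g x w (ξ x) - ε * (g x v (J x (ξ x)) * g x w (J x (ξ x)))) = _
  ring

variable [IsManifold 𝓘(ℝ, E) ∞ M]

/-- Smooth vector fields. -/
def SmoothVField (X : VField E M) : Prop :=
  ContMDiff 𝓘(ℝ, E) (𝓘(ℝ, E).prod 𝓘(ℝ, E)) ∞
    (fun x ↦ Bundle.TotalSpace.mk' E x (X x))

/-- The vector field `X` is differentiable at the point `x`. -/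
def DiffVFieldAt (X : VField E M) (x : M) : Prop :=
  MDifferentiableAt 𝓘(ℝ, E) (𝓘(ℝ, E).prod 𝓘(ℝ, E))
    (fun y ↦ Bundle.TotalSpace.mk' E y (X y)) x

/-- Smooth (1,1)-tensor fields. -/
def SmoothEndField (J : EndField E M) : Prop :=
  ContMDiff 𝓘(ℝ, E) (𝓘(ℝ, E).prod 𝓘(ℝ, E →L[ℝ] E)) ∞
    (fun x ↦ Bundle.TotalSpace.mk' (E →L[ℝ] E) x (J x))

/-- Smooth (0,2)-tensor fields. -/
def SmoothBilinField (g : BilinField E M) : Prop :=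
  ContMDiff 𝓘(ℝ, E) (𝓘(ℝ, E).prod 𝓘(ℝ, E →L[ℝ] E →L[ℝ] ℝ)) ∞
    (fun x ↦ Bundle.TotalSpace.mk' (E →L[ℝ] E →L[ℝ] ℝ) x (g x))

/-- `(D_v J) Y = D_v (J Y) - J (D_v Y)` at the point `x`. -/
def covEnd (D : Connection E M) (J : EndField E M) (Y : VField E M) (x : M)
    (v : TangentSpace 𝓘(ℝ, E) x) : TangentSpace 𝓘(ℝ, E) x :=
  D (fun y ↦ J y (Y y)) x v - J x (D Y x v)

/-- `(D_v b)(Y, Z) = v (b(Y, Z)) - b(D_v Y, Z) - b(Y, D_v Z)` at the point `x`. -/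
def covBilin (D : Connection E M) (b : BilinField E M) (Y Z : VField E M) (x : M)
    (v : TangentSpace 𝓘(ℝ, E) x) : ℝ :=
  mvfderiv 𝓘(ℝ, E) (fun y ↦ b y (Y y) (Z y)) x v - b x (D Y x v) (Z x) - b x (Y x) (D Z x v)

/-- `D J = 0`. -/
def ParallelEnd (D : Connection E M) (J : EndField E M) : Prop :=
  ∀ (x : M) (Y : VField E M), DiffVFieldAt Y x → ∀ v, covEnd D J Y x v = 0

/-- `D b = 0`. -/
def ParallelBilin (D : Connection E M) (b : BilinField E M) : Prop :=
  ∀ (x : M) (Y Z : VField E M), DiffVFieldAt Y x → DiffVFieldAt Z x →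
    ∀ v, covBilin D b Y Z x v = 0

/-- A pseudo-Riemannian metric: a smooth field of nondegenerate symmetric bilinear forms. -/
structure IsPseudoRiemannian (g : BilinField E M) : Prop where
  smooth : SmoothBilinField g
  symm : ∀ x v w, g x v w = g x w v
  nondegenerate : ∀ x v, (∀ w, g x v w = 0) → v = 0

/-- The Nijenhuis tensor of `J` on the vector fields `X`, `Y`:
`[JX, JY] - J[JX, Y] - J[X, JY] + J²[X, Y]`. -/
def nijenhuis (J : EndField E M) (X Y : VField E M) (x : M) : TangentSpace 𝓘(ℝ, E) x :=
  VectorField.mlieBracket 𝓘(ℝ, E) (fun y ↦ J y (X y)) (fun y ↦ J y (Y y)) x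
    - J x (VectorField.mlieBracket 𝓘(ℝ, E) (fun y ↦ J y (X y)) Y x)
    - J x (VectorField.mlieBracket 𝓘(ℝ, E) X (fun y ↦ J y (Y y)) x)
    + J x (J x (VectorField.mlieBracket 𝓘(ℝ, E) X Y x))

/-- `J` is an integrable `ε`-complex structure: a complex structure for `ε = -1` and a para-complex
structure for `ε = 1`. The condition on the ranks of the `±1`-eigenspaces is part of the definition
of a para-complex structure; for `ε = -1` both eigenspaces are zero. -/
structure IsEpsComplex (ε : ℝ) (J : EndField E M) : Prop where
  smooth : SmoothEndField J
  sq : ∀ x v, J x (J x v) = ε • v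
  rank_eq : ∀ x,
    Module.finrank ℝ (Module.End.eigenspace
      ((J x : TangentSpace 𝓘(ℝ, E) x →L[ℝ] TangentSpace 𝓘(ℝ, E) x) :
        TangentSpace 𝓘(ℝ, E) x →ₗ[ℝ] TangentSpace 𝓘(ℝ, E) x) 1)
    = Module.finrank ℝ (Module.End.eigenspace
      ((J x : TangentSpace 𝓘(ℝ, E) x →L[ℝ] TangentSpace 𝓘(ℝ, E) x) :
        TangentSpace 𝓘(ℝ, E) x →ₗ[ℝ] TangentSpace 𝓘(ℝ, E) x) (-1))
  integrable : ∀ X Y : VField E M, SmoothVField X → SmoothVField Y → ∀ x, nijenhuis J X Y x = 0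

variable [FiniteDimensional ℝ E]

/-- `D` is the Levi-Civita connection of `g`: torsion-free and metric. These two properties
determine `D` on differentiable vector fields and imply that `D` is smooth. -/
structure IsLeviCivita (g : BilinField E M) (D : Connection E M) : Prop where
  torsion_eq_zero : D.torsion = 0
  metric : ParallelBilin D g

/-- `D` has zero curvature `R(X, Y) Z = D_X D_Y Z - D_Y D_X Z - D_[X, Y] Z`. -/
def IsFlat (D : Connection E M) : Prop :=
  ∀ X Y Z : VField E M, SmoothVField X → SmoothVField Y → SmoothVField Z → ∀ x,
    D (fun y ↦ D Z y (Y y)) x (X x) - D (fun y ↦ D Z y (X y)) x (Y x)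
      - D Z x (VectorField.mlieBracket 𝓘(ℝ, E) X Y x) = 0

/-- `(M, J, g)` is an `ε`-Kähler manifold: `g` is a pseudo-Riemannian metric and `J` is a
skew-symmetric endomorphism field with `J² = ε Id` which is parallel for the Levi-Civita
connection of `g`. -/
structure IsEpsKahler (ε : ℝ) (J : EndField E M) (g : BilinField E M) : Prop where
  metric : IsPseudoRiemannian g
  smooth : SmoothEndField J
  sq : ∀ x v, J x (J x v) = ε • v
  skew : ∀ x v w, g x (J x v) w = -g x v (J x w)
  parallel : ∃ D : Connection E M, IsLeviCivita g D ∧ ParallelEnd D J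

/-- `(M, J, g, ∇)` is an affine special `ε`-Kähler manifold: an `ε`-Kähler manifold with a (smooth)
flat torsion-free connection `∇` such that `∇ω = 0` and `(∇_X J) Y = (∇_Y J) X`. -/
structure IsAffineSpecial (ε : ℝ) (J : EndField E M) (g : BilinField E M)
    (nabla : Connection E M) : Prop where
  kahler : IsEpsKahler ε J g
  smooth : CovariantDerivative.ContMDiffCovariantDerivative nabla ∞
  torsion_eq_zero : nabla.torsion = 0
  flat : IsFlat nabla
  symplectic : ParallelBilin nabla (kahlerForm ε g J)
  symmetric : ∀ (x : M) (X Y : VField E M), DiffVFieldAt X x → DiffVFieldAt Y x →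
    covEnd nabla J Y x (X x) = covEnd nabla J X x (Y x)

/-- `(M, J, g, ∇, ξ)` is a conical affine special `ε`-Kähler manifold: `∇ξ = Dξ = Id`, where `D` is
the Levi-Civita connection of `g`. -/
structure IsConicalSpecial (ε : ℝ) (J : EndField E M) (g : BilinField E M)
    (nabla : Connection E M) (ξ : VField E M) : Prop where
  special : IsAffineSpecial ε J g nabla
  smooth : SmoothVField ξ
  nabla_xi : ∀ x v, nabla ξ x v = v
  leviCivita_xi : ∃ D : Connection E M, IsLeviCivita g D ∧ ∀ x v, D ξ x v = v

end Tensors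

section Leaves

variable {E : Type*} [NormedAddCommGroup E] [NormedSpace ℝ E]
  {M : Type*} [TopologicalSpace M] [ChartedSpace E M]

/-- The distribution `𝒟_x = span {ξ_x, J ξ_x}`. -/
def leafDist (J : EndField E M) (ξ : VField E M) (x : M) : Submodule ℝ (TangentSpace 𝓘(ℝ, E) x) :=
  Submodule.span ℝ {ξ x, J x (ξ x)}

/-- The points `p` and `q` are joined by a curve `γ : [a, b] → M` tangent to `𝒟`. -/
def JoinedByTangentCurve (J : EndField E M) (ξ : VField E M) (p q : M) : Prop :=
  ∃ (γ : ℝ → M) (a b : ℝ), a ≤ b ∧ γ a = p ∧ γ b = q ∧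
    ∀ t ∈ Set.Icc a b, ∃ v ∈ leafDist J ξ (γ t),
      HasMFDerivWithinAt 𝓘(ℝ, ℝ) 𝓘(ℝ, E) γ (Set.Icc a b) t
        ((1 : ℝ →L[ℝ] ℝ).smulRight (v : TangentSpace 𝓘(ℝ, E) (γ t)))

/-- Two points lie on the same leaf (maximal connected integral surface) of `𝒟` if and only if they
are joined by a finite chain of curves tangent to `𝒟`. -/
def leafSetoid (J : EndField E M) (ξ : VField E M) : Setoid M :=
  Relation.EqvGen.setoid (JoinedByTangentCurve J ξ)

/-- The space of leaves of `𝒟`. -/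
def LeafSpace (J : EndField E M) (ξ : VField E M) : Type _ := Quotient (leafSetoid J ξ)

/-- The quotient topology on the space of leaves. -/
instance (J : EndField E M) (ξ : VField E M) : TopologicalSpace (LeafSpace J ξ) :=
  inferInstanceAs (TopologicalSpace (Quotient (leafSetoid J ξ)))

/-- The canonical quotient map `π` onto the space of leaves. -/
def leafProj (J : EndField E M) (ξ : VField E M) : M → LeafSpace J ξ :=
  Quotient.mk (leafSetoid J ξ)

end Leaves

section Regular

variable {E : Type*} [NormedAddCommGroup E] [NormedSpace ℝ E]
  {M : Type*} [TopologicalSpace M] [ChartedSpace E M]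
  {E' : Type*} [NormedAddCommGroup E'] [NormedSpace ℝ E']
  {N : Type*} [TopologicalSpace N] [ChartedSpace E' N]

/-- A map `f : (M, J) → (N, J')` is holomorphic if it is smooth and `df J = J' df`. -/
structure IsHolomorphic (J : EndField E M) (J' : EndField E' N) (f : M → N) : Prop where
  smooth : ContMDiff 𝓘(ℝ, E) 𝓘(ℝ, E') ∞ f
  comm : ∀ x v, mfderiv 𝓘(ℝ, E) 𝓘(ℝ, E') f x (J x v) =
    J' (f x) (mfderiv 𝓘(ℝ, E) 𝓘(ℝ, E') f x v)

/-- `f^* b = h` for (0,2)-tensor fields `b` on the target and `h` on the source of `f`. -/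
def PullbackEq (f : M → N) (b : BilinField E' N) (h : BilinField E M) : Prop :=
  ∀ x v w, b (f x) (mfderiv 𝓘(ℝ, E) 𝓘(ℝ, E') f x v) (mfderiv 𝓘(ℝ, E) 𝓘(ℝ, E') f x w) = h x v w

/-- Regularity of `(M, J, g, ξ)`, where the space of leaves carries a smooth structure and the
endomorphism field `J'`: the function `g(ξ, ξ)` has no zeros, the space of leaves is a Hausdorff
`ε`-complex manifold and `π` is a holomorphic submersion. -/
structure IsRegular (ε : ℝ) (J : EndField E M) (g : BilinField E M) (ξ : VField E M)
    [ChartedSpace E' (LeafSpace J ξ)] [IsManifold 𝓘(ℝ, E') ∞ (LeafSpace J ξ)]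
    (J' : EndField E' (LeafSpace J ξ)) : Prop where
  ne_zero : ∀ x, g x (ξ x) (ξ x) ≠ 0
  hausdorff : T2Space (LeafSpace J ξ)
  complex : IsEpsComplex ε J'
  submersion : Manifold.IsSubmersion 𝓘(ℝ, E) 𝓘(ℝ, E') ∞ (leafProj J ξ)
  holomorphic : IsHolomorphic J J' (leafProj J ξ)

end Regular

end EpsKahler
end

open scoped Manifold ContDiff Bundle

noncomputable section

namespace EpsKahler

open VectorField Set Filter Topology

/-! ### Lie brackets acting on functions, and related vector fields -/

section Bracket

variable {E : Type*} [NormedAddCommGroup E] [NormedSpace ℝ E]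
  {M : Type*} [TopologicalSpace M] [ChartedSpace E M] [IsManifold 𝓘(ℝ, E) ∞ M]
  {F : Type*} [NormedAddCommGroup F] [NormedSpace ℝ F]

/-! Write `p` for the leaf projection and `f = g(ξ, ξ)`. The fields `ξ` and `Jξ` are vertical,
mutually orthogonal, and of square norms `f` and `-εf`. Hence `g` is nondegenerate on their span,
and by dimension `dp` identifies its orthogonal complement with the tangent space below. The tensor
`h` is `g / f` evaluated on horizontal parts (`hTensor_eq`).

It descends because `g / f` on horizontal lifts is constant along leaves
(`mvfderiv_fibreForm_eq_zero`). Brackets of vertical fields with lifts are vertical, so only the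
derivatives of `ξ` and `Jξ` enter. From `Dξ = Id`, the flow of `ξ` scales `g` and `f` alike. From
`D(Jξ) = J` and skewness of `J`, the field `Jξ` is Killing and preserves `f`. Points of one fibre
are joined by curves tangent to the distribution, so the values agree on fibres. Local sections make
the descended form smooth, and surjectivity of `p` and `dp` makes it unique.

The Levi-Civita connection below is `dp` of the derivative of one lift along another, as for a
Riemannian submersion. The factor `1 / f` does no harm, since `df = 2g(·, ξ)` vanishes on horizontal
vectors. As `J` maps the lift of `A` to the lift of `J'A` (`end_lift`), skewness and parallelism
pass from `J` to `J'`. -/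

theorem IsInvertible.apply_inverse_apply {V W : Type*} [AddCommGroup V] [Module ℝ V]
    [TopologicalSpace V] [AddCommGroup W] [Module ℝ W] [TopologicalSpace W] {A : V →L[ℝ] W}
    (hA : A.IsInvertible) (w : W) : A (A.inverse w) = w := by
  obtain ⟨e, rfl⟩ := hA
  simp

theorem differentiableAt_comp_extChartAt_symm {f : M → F} {x y : M}
    (hf : MDifferentiableAt 𝓘(ℝ, E) 𝓘(ℝ, F) f y) (hy : y ∈ (extChartAt 𝓘(ℝ, E) x).source) :
    DifferentiableAt ℝ (f ∘ (extChartAt 𝓘(ℝ, E) x).symm) (extChartAt 𝓘(ℝ, E) x y) := by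
  have h : MDifferentiableAt 𝓘(ℝ, E) 𝓘(ℝ, F) (f ∘ (extChartAt 𝓘(ℝ, E) x).symm)
      (extChartAt 𝓘(ℝ, E) x y) := by
    apply MDifferentiableAt.comp (I' := 𝓘(ℝ, E))
    · rwa [(extChartAt 𝓘(ℝ, E) x).left_inv hy]
    · rw [← mdifferentiableWithinAt_univ, ← ModelWithCorners.range_eq_univ 𝓘(ℝ, E)]
      exact mdifferentiableWithinAt_extChartAt_symm ((extChartAt 𝓘(ℝ, E) x).map_source hy)
  exact h.differentiableAt

/-- The chart stays centred at `x` while `y` varies, so that the formula can be differentiated once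
more in `y`. -/
theorem mvfderiv_apply_eq_fderiv_mfderiv_extChartAt {f : M → F} {x y : M}
    (hf : MDifferentiableAt 𝓘(ℝ, E) 𝓘(ℝ, F) f y) (hy : y ∈ (extChartAt 𝓘(ℝ, E) x).source)
    (v : TangentSpace 𝓘(ℝ, E) y) :
    mvfderiv 𝓘(ℝ, E) f y v = fderiv ℝ (f ∘ (extChartAt 𝓘(ℝ, E) x).symm) (extChartAt 𝓘(ℝ, E) x y)
      (mfderiv 𝓘(ℝ, E) 𝓘(ℝ, E) (extChartAt 𝓘(ℝ, E) x) y v) := by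
  have heq : f =ᶠ[𝓝 y] (f ∘ (extChartAt 𝓘(ℝ, E) x).symm) ∘ extChartAt 𝓘(ℝ, E) x := by
    filter_upwards [(isOpen_extChartAt_source (I := 𝓘(ℝ, E)) x).mem_nhds hy] with z hz
    simp only [Function.comp_apply, (extChartAt 𝓘(ℝ, E) x).left_inv hz]
  have e1 : mfderiv 𝓘(ℝ, E) 𝓘(ℝ, F) f y = (mfderiv 𝓘(ℝ, E) 𝓘(ℝ, F)
      (f ∘ (extChartAt 𝓘(ℝ, E) x).symm) (extChartAt 𝓘(ℝ, E) x y)).comp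
        (mfderiv 𝓘(ℝ, E) 𝓘(ℝ, E) (extChartAt 𝓘(ℝ, E) x) y) := by
    rw [heq.mfderiv_eq]
    exact mfderiv_comp y (differentiableAt_comp_extChartAt_symm hf hy).mdifferentiableAt
      (mdifferentiableAt_extChartAt (by simpa using hy))
  change mfderiv 𝓘(ℝ, E) 𝓘(ℝ, F) f y v = _
  rw [e1, mfderiv_eq_fderiv]
  rfl

/-- The derivative of a function along a vector field, read in the chart around `x`. -/
theorem eventually_mvfderiv_apply_eq_fderiv {f : M → F} {x : M}
    (hf : ContMDiffAt 𝓘(ℝ, E) 𝓘(ℝ, F) 2 f x) (V : VField E M) :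
    (fun y ↦ mvfderiv 𝓘(ℝ, E) f y (V y)) =ᶠ[𝓝 x]
      (fun z ↦ fderiv ℝ (f ∘ (extChartAt 𝓘(ℝ, E) x).symm) z
        (mpullbackWithin 𝓘(ℝ, E) 𝓘(ℝ, E) (extChartAt 𝓘(ℝ, E) x).symm V univ z)) ∘
        extChartAt 𝓘(ℝ, E) x := by
  have h1 := eventuallyEq_mpullback_mpullbackWithin_extChartAt (I := 𝓘(ℝ, E)) (s := univ) (x := x) V
  rw [nhdsWithin_univ] at h1
  have h2 : ∀ᶠ y in 𝓝 x, y ∈ (extChartAt 𝓘(ℝ, E) x).source := extChartAt_source_mem_nhds x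
  have h3 := (contMDiffAt_iff_contMDiffAt_nhds (by simp)).1 hf
  filter_upwards [h1, h2, h3] with y h1 h2 h3
  have e2 : mfderiv 𝓘(ℝ, E) 𝓘(ℝ, E) (extChartAt 𝓘(ℝ, E) x) y (V y) =
      mpullbackWithin 𝓘(ℝ, E) 𝓘(ℝ, E) (extChartAt 𝓘(ℝ, E) x).symm V univ
        (extChartAt 𝓘(ℝ, E) x y) := by
    rw [h1, mpullback_apply, modelWithCornersSelf_coe, range_id]
    exact IsInvertible.apply_inverse_apply (isInvertible_mfderiv_extChartAt h2) _
  rw [mvfderiv_apply_eq_fderiv_mfderiv_extChartAt (h3.mdifferentiableAt two_ne_zero) h2, e2]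
  rfl

variable [CompleteSpace E]

theorem differentiableAt_mpullbackWithin_extChartAt_symm {U : VField E M} {x : M}
    (hU : DiffVFieldAt U x) : DifferentiableAt ℝ
      (mpullbackWithin 𝓘(ℝ, E) 𝓘(ℝ, E) (extChartAt 𝓘(ℝ, E) x).symm U univ)
      (extChartAt 𝓘(ℝ, E) x x) := by
  have := (mdifferentiableWithinAt_univ.2 hU).differentiableWithinAt_mpullbackWithin_vectorField
  rw [modelWithCornersSelf_coe, range_id, preimage_univ, univ_inter] at this
  exact differentiableWithinAt_univ.1 this

theorem differentiableAt_fderiv_apply_mpullbackWithin {f : M → F} {x : M}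
    (hf : ContMDiffAt 𝓘(ℝ, E) 𝓘(ℝ, F) 2 f x) {U : VField E M} (hU : DiffVFieldAt U x) :
    DifferentiableAt ℝ (fun z ↦ fderiv ℝ (f ∘ (extChartAt 𝓘(ℝ, E) x).symm) z
        (mpullbackWithin 𝓘(ℝ, E) 𝓘(ℝ, E) (extChartAt 𝓘(ℝ, E) x).symm U univ z))
      (extChartAt 𝓘(ℝ, E) x x) := by
  have hfh : ContDiffAt ℝ 2 (f ∘ (extChartAt 𝓘(ℝ, E) x).symm) (extChartAt 𝓘(ℝ, E) x x) := by
    have := (contMDiffAt_iff.1 hf).2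
    simpa using! this
  exact ((hfh.fderiv_right (m := 1) (by norm_num)).differentiableAt one_ne_zero).clm_apply
    (differentiableAt_mpullbackWithin_extChartAt_symm hU)

theorem mdifferentiableAt_mvfderiv_apply {f : M → F} {x : M}
    (hf : ContMDiffAt 𝓘(ℝ, E) 𝓘(ℝ, F) 2 f x) {U : VField E M} (hU : DiffVFieldAt U x) :
    MDifferentiableAt 𝓘(ℝ, E) 𝓘(ℝ, F) (fun y ↦ mvfderiv 𝓘(ℝ, E) f y (U y)) x :=
  ((differentiableAt_fderiv_apply_mpullbackWithin hf hU).mdifferentiableAt.comp x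
    (mdifferentiableAt_extChartAt (mem_chart_source E x))).congr_of_eventuallyEq
    (eventually_mvfderiv_apply_eq_fderiv hf U)

/-- The derivative of a function along the Lie bracket of two vector fields is the commutator of
the derivatives along the vector fields. -/
theorem mvfderiv_mlieBracket {f : M → F} {x : M} (hf : ContMDiffAt 𝓘(ℝ, E) 𝓘(ℝ, F) 2 f x)
    {V W : VField E M} (hV : DiffVFieldAt V x) (hW : DiffVFieldAt W x) :
    mvfderiv 𝓘(ℝ, E) f x (mlieBracket 𝓘(ℝ, E) V W x) =
      mvfderiv 𝓘(ℝ, E) (fun y ↦ mvfderiv 𝓘(ℝ, E) f y (W y)) x (V x) -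
      mvfderiv 𝓘(ℝ, E) (fun y ↦ mvfderiv 𝓘(ℝ, E) f y (V y)) x (W x) := by
  have hx := mem_extChartAt_source (I := 𝓘(ℝ, E)) x
  have hfd := hf.mdifferentiableAt two_ne_zero
  have hval (U : VField E M) : mfderiv 𝓘(ℝ, E) 𝓘(ℝ, E) (extChartAt 𝓘(ℝ, E) x) x (U x) =
      mpullbackWithin 𝓘(ℝ, E) 𝓘(ℝ, E) (extChartAt 𝓘(ℝ, E) x).symm U univ
        (extChartAt 𝓘(ℝ, E) x x) := by
    have h1 := eventuallyEq_mpullback_mpullbackWithin_extChartAt (I := 𝓘(ℝ, E)) (s := univ)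
      (x := x) U
    rw [nhdsWithin_univ] at h1
    rw [h1.self_of_nhds, mpullback_apply, modelWithCornersSelf_coe, range_id]
    exact IsInvertible.apply_inverse_apply (isInvertible_mfderiv_extChartAt hx) _
  have hfh : ContDiffAt ℝ 2 (f ∘ (extChartAt 𝓘(ℝ, E) x).symm) (extChartAt 𝓘(ℝ, E) x x) := by
    have := (contMDiffAt_iff.1 hf).2
    simpa using! this
  have hder (U : VField E M) (hU : DiffVFieldAt U x) (v : VField E M) :
      mvfderiv 𝓘(ℝ, E) (fun y ↦ mvfderiv 𝓘(ℝ, E) f y (U y)) x (v x) =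
      fderiv ℝ (fun z ↦ fderiv ℝ (f ∘ (extChartAt 𝓘(ℝ, E) x).symm) z
        (mpullbackWithin 𝓘(ℝ, E) 𝓘(ℝ, E) (extChartAt 𝓘(ℝ, E) x).symm U univ z))
      (extChartAt 𝓘(ℝ, E) x x) (mpullbackWithin 𝓘(ℝ, E) 𝓘(ℝ, E) (extChartAt 𝓘(ℝ, E) x).symm v univ
        (extChartAt 𝓘(ℝ, E) x x)) := by
    have h := eventually_mvfderiv_apply_eq_fderiv hf U
    change mfderiv 𝓘(ℝ, E) 𝓘(ℝ, F) (fun y ↦ mvfderiv 𝓘(ℝ, E) f y (U y)) x (v x) = _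
    rw [h.mfderiv_eq, mfderiv_comp x (differentiableAt_fderiv_apply_mpullbackWithin hf hU).mdifferentiableAt
      (mdifferentiableAt_extChartAt (mem_chart_source E x)), mfderiv_eq_fderiv, ← hval v]
    rfl
  rw [hder W hW, hder V hV, mvfderiv_apply_eq_fderiv_mfderiv_extChartAt hfd hx]
  have hb : mfderiv 𝓘(ℝ, E) 𝓘(ℝ, E) (extChartAt 𝓘(ℝ, E) x) x (mlieBracket 𝓘(ℝ, E) V W x) =
      lieBracket ℝ
        (mpullbackWithin 𝓘(ℝ, E) 𝓘(ℝ, E) (extChartAt 𝓘(ℝ, E) x).symm V univ)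
        (mpullbackWithin 𝓘(ℝ, E) 𝓘(ℝ, E) (extChartAt 𝓘(ℝ, E) x).symm W univ)
        (extChartAt 𝓘(ℝ, E) x x) := by
    rw [← mlieBracketWithin_univ, mlieBracketWithin_apply, modelWithCornersSelf_coe, range_id,
      preimage_univ, univ_inter]
    refine (IsInvertible.apply_inverse_apply (isInvertible_mfderiv_extChartAt hx) _).trans ?_
    exact congrFun (lieBracketWithin_univ (𝕜 := ℝ) (E := E)) _
  rw [hb]
  -- In the chart the claim is the symmetry of the second derivative.
  exact fderiv_apply_lieBracket hfh (by simp)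
    (differentiableAt_mpullbackWithin_extChartAt_symm hW)
    (differentiableAt_mpullbackWithin_extChartAt_symm hV)

variable {E' : Type*} [NormedAddCommGroup E'] [NormedSpace ℝ E'] [CompleteSpace E']
  {N : Type*} [TopologicalSpace N] [ChartedSpace E' N] [IsManifold 𝓘(ℝ, E') ∞ N]

omit [CompleteSpace E] [CompleteSpace E'] [IsManifold 𝓘(ℝ, E) ∞ M] [IsManifold 𝓘(ℝ, E') ∞ N] in
theorem mvfderiv_comp_apply_eq {f : N → F} {p : M → N} {x : M}
    (hf : MDifferentiableAt 𝓘(ℝ, E') 𝓘(ℝ, F) f (p x))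
    (hp : MDifferentiableAt 𝓘(ℝ, E) 𝓘(ℝ, E') p x) (v : TangentSpace 𝓘(ℝ, E) x) :
    mvfderiv 𝓘(ℝ, E) (f ∘ p) x v =
      mvfderiv 𝓘(ℝ, E') f (p x) (mfderiv 𝓘(ℝ, E) 𝓘(ℝ, E') p x v) := by
  change mfderiv 𝓘(ℝ, E) 𝓘(ℝ, F) (f ∘ p) x v = _
  rw [mfderiv_comp x hf hp]
  rfl

theorem two_le_infty : (2 : WithTop ℕ∞) ≤ ∞ := by decide

/-- The Lie brackets of `p`-related vector fields are `p`-related. -/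
theorem mfderiv_mlieBracket_of_related {p : M → N} (hp : ContMDiff 𝓘(ℝ, E) 𝓘(ℝ, E') ∞ p) {x : M}
    {V W : VField E M} {V' W' : VField E' N}
    (hV : DiffVFieldAt V x) (hW : DiffVFieldAt W x)
    (hV' : DiffVFieldAt V' (p x)) (hW' : DiffVFieldAt W' (p x))
    (hVV' : ∀ y, mfderiv 𝓘(ℝ, E) 𝓘(ℝ, E') p y (V y) = V' (p y))
    (hWW' : ∀ y, mfderiv 𝓘(ℝ, E) 𝓘(ℝ, E') p y (W y) = W' (p y)) :
    mfderiv 𝓘(ℝ, E) 𝓘(ℝ, E') p x (mlieBracket 𝓘(ℝ, E) V W x) =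
      mlieBracket 𝓘(ℝ, E') V' W' (p x) := by
  -- The vector-valued function `φ` has invertible derivative at `p x`, so it suffices to compare
  -- how both brackets differentiate it.
  set φ := extChartAt 𝓘(ℝ, E') (p x) with hφ
  have hφx : ContMDiffAt 𝓘(ℝ, E') 𝓘(ℝ, E') 2 φ (p x) := contMDiffAt_extChartAt
  have hpd (y : M) : MDifferentiableAt 𝓘(ℝ, E) 𝓘(ℝ, E') p y :=
    (hp y).mdifferentiableAt (by simp)
  have hφp : ContMDiffAt 𝓘(ℝ, E) 𝓘(ℝ, E') 2 (φ ∘ p) x :=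
    hφx.comp x ((hp x).of_le two_le_infty)
  have hφd : ∀ᶠ y in 𝓝 x, MDifferentiableAt 𝓘(ℝ, E') 𝓘(ℝ, E') φ (p y) := by
    filter_upwards [(hp x).continuousAt.eventually
      ((chartAt E' (p x)).open_source.mem_nhds (mem_chart_source E' (p x)))] with y hy
    exact mdifferentiableAt_extChartAt hy
  have key (U W : VField E M) (U' W' : VField E' N) (hU' : DiffVFieldAt U' (p x))
      (hUU' : ∀ y, mfderiv 𝓘(ℝ, E) 𝓘(ℝ, E') p y (U y) = U' (p y))
      (hWW' : ∀ y, mfderiv 𝓘(ℝ, E) 𝓘(ℝ, E') p y (W y) = W' (p y)) :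
      mvfderiv 𝓘(ℝ, E) (fun y ↦ mvfderiv 𝓘(ℝ, E) (φ ∘ p) y (U y)) x (W x) =
      mvfderiv 𝓘(ℝ, E') (fun q ↦ mvfderiv 𝓘(ℝ, E') φ q (U' q)) (p x) (W' (p x)) := by
    have h : (fun y ↦ mvfderiv 𝓘(ℝ, E) (φ ∘ p) y (U y)) =ᶠ[𝓝 x]
        (fun q ↦ mvfderiv 𝓘(ℝ, E') φ q (U' q)) ∘ p := by
      filter_upwards [hφd] with y hy
      rw [mvfderiv_comp_apply_eq hy (hpd y), hUU']
      rfl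
    rw [← hWW', ← mvfderiv_comp_apply_eq (N := N) (E' := E') (p := p)
      (mdifferentiableAt_mvfderiv_apply hφx hU') (hpd x)]
    exact congrArg (fun A : E →L[ℝ] E' ↦ A (W x)) h.mfderiv_eq
  have h1 := mvfderiv_mlieBracket hφp hV hW
  rw [key _ _ _ _ hW' hWW' hVV', key _ _ _ _ hV' hVV' hWW', ← mvfderiv_mlieBracket hφx hV' hW',
    mvfderiv_comp_apply_eq hφd.self_of_nhds (hpd x)] at h1
  obtain ⟨e, he⟩ := isInvertible_mfderiv_extChartAt (I := 𝓘(ℝ, E')) (mem_extChartAt_source (p x))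
  have h2 (u : TangentSpace 𝓘(ℝ, E') (p x)) : mvfderiv 𝓘(ℝ, E') φ (p x) u = e u := by
    change mfderiv 𝓘(ℝ, E') 𝓘(ℝ, E') φ (p x) u = e u
    rw [← hφ] at he
    rw [← he]
    rfl
  rw [h2, h2] at h1
  exact e.injective h1

end Bracket

/-! ### Calculus of tensor fields and uniqueness of the Levi-Civita connection -/

section LeviCivita

variable {E : Type*} [NormedAddCommGroup E] [NormedSpace ℝ E]
  {M : Type*} [TopologicalSpace M] [ChartedSpace E M] [IsManifold 𝓘(ℝ, E) ∞ M]

theorem SmoothVField.diffVFieldAt {X : VField E M} (hX : SmoothVField X) (x : M) :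
    DiffVFieldAt X x := (hX x).mdifferentiableAt (by simp)

theorem SmoothEndField.diffVFieldAt_apply {J : EndField E M} (hJ : SmoothEndField J)
    {Y : VField E M} {x : M} (hY : DiffVFieldAt Y x) : DiffVFieldAt (fun y ↦ J y (Y y)) x :=
  ((hJ x).mdifferentiableAt (by simp)).clm_bundle_apply hY

theorem SmoothEndField.smoothVField_apply {J : EndField E M} (hJ : SmoothEndField J)
    {Y : VField E M} (hY : SmoothVField Y) : SmoothVField (fun y ↦ J y (Y y)) :=
  fun x ↦ (hJ x).clm_bundle_apply (hY x)

theorem SmoothBilinField.mdifferentiableAt_apply {b : BilinField E M} (hb : SmoothBilinField b)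
    {Y Z : VField E M} {x : M} (hY : DiffVFieldAt Y x) (hZ : DiffVFieldAt Z x) :
    MDifferentiableAt 𝓘(ℝ, E) 𝓘(ℝ, ℝ) (fun y ↦ b y (Y y) (Z y)) x := by
  have : MDifferentiableAt 𝓘(ℝ, E) (𝓘(ℝ, E).prod 𝓘(ℝ, ℝ))
      (fun m ↦ Bundle.TotalSpace.mk' ℝ (E := Bundle.Trivial M ℝ) m (b m (Y m) (Z m))) x :=
    MDifferentiableAt.clm_bundle_apply₂ (F₁ := E) (F₂ := E)
      ((hb x).mdifferentiableAt (by simp)) hY hZ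
  rw [mdifferentiableAt_totalSpace] at this
  exact this.2

/-- Lets pointwise identities be proved with fields. Differentiability at the single point `x`
suffices throughout, so no cutoff functions enter. -/
theorem exists_diffVFieldAt_eq {x : M} (v : TangentSpace 𝓘(ℝ, E) x) :
    ∃ Y : VField E M, DiffVFieldAt Y x ∧ Y x = v :=
  ⟨FiberBundle.extend E v, FiberBundle.mdifferentiableAt_extend _ _ v, by simp⟩

theorem ParallelBilin.mvfderiv_apply {D : Connection E M} {b : BilinField E M}
    (h : ParallelBilin D b) {Y Z : VField E M} {x : M} (hY : DiffVFieldAt Y x)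
    (hZ : DiffVFieldAt Z x) (v : TangentSpace 𝓘(ℝ, E) x) :
    mvfderiv 𝓘(ℝ, E) (fun y ↦ b y (Y y) (Z y)) x v = b x (D Y x v) (Z x) + b x (Y x) (D Z x v) := by
  have := h x Y Z hY hZ v
  unfold covBilin at this
  linarith

theorem ParallelEnd.covariantDerivative_apply {D : Connection E M} {J : EndField E M}
    (h : ParallelEnd D J) {Y : VField E M} {x : M} (hY : DiffVFieldAt Y x)
    (v : TangentSpace 𝓘(ℝ, E) x) : D (fun y ↦ J y (Y y)) x v = J x (D Y x v) :=
  sub_eq_zero.1 (h x Y hY v)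

variable [FiniteDimensional ℝ E]

theorem IsLeviCivita.sub_eq_mlieBracket {D : Connection E M} {g : BilinField E M}
    (h : IsLeviCivita g D) {X Y : VField E M} {x : M} (hX : DiffVFieldAt X x)
    (hY : DiffVFieldAt Y x) : D Y x (X x) - D X x (Y x) = mlieBracket 𝓘(ℝ, E) X Y x :=
  D.torsion_eq_zero_iff.1 h.torsion_eq_zero hX hY

/-- A Levi-Civita connection is determined by the metric on differentiable vector fields. -/
theorem IsLeviCivita.eq_of_diffVFieldAt {D D' : Connection E M} {g : BilinField E M}
    (hg : IsPseudoRiemannian g) (h : IsLeviCivita g D) (h' : IsLeviCivita g D')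
    {Y : VField E M} {x : M} (hY : DiffVFieldAt Y x) (v : TangentSpace 𝓘(ℝ, E) x) :
    D Y x v = D' Y x v := by
  obtain ⟨X, hX, rfl⟩ := exists_diffVFieldAt_eq v
  have symm (X Y Z : VField E M) (hX : DiffVFieldAt X x) (hY : DiffVFieldAt Y x) :
      g x (D Y x (X x) - D' Y x (X x)) (Z x) = g x (D X x (Y x) - D' X x (Y x)) (Z x) := by
    have e : D Y x (X x) - D' Y x (X x) = D X x (Y x) - D' X x (Y x) := by
      have := (h.sub_eq_mlieBracket hX hY).trans (h'.sub_eq_mlieBracket hX hY).symm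
      rw [sub_eq_sub_iff_add_eq_add] at this ⊢
      rw [this, add_comm]
    rw [e]
  have skew (X Y Z : VField E M) (hY : DiffVFieldAt Y x) (hZ : DiffVFieldAt Z x) :
      g x (D Y x (X x) - D' Y x (X x)) (Z x) = - g x (D Z x (X x) - D' Z x (X x)) (Y x) := by
    have e1 := h.metric.mvfderiv_apply hY hZ (X x)
    have e2 := h'.metric.mvfderiv_apply hY hZ (X x)
    rw [hg.symm x (Y x)] at e1 e2
    simp only [map_sub, sub_apply]
    linarith
  refine sub_eq_zero.1 (hg.nondegenerate x _ fun w ↦ ?_)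
  obtain ⟨Z, hZ, rfl⟩ := exists_diffVFieldAt_eq w
  -- The difference of the connections, paired with `g`, is symmetric in its first two arguments and
  -- skew in the last two. Six alternating swaps return it to itself with the opposite sign.
  have e1 := skew X Y Z hY hZ
  have e2 := symm X Z Y hX hZ
  have e3 := skew Z X Y hX hY
  have e4 := symm Z Y X hZ hY
  have e5 := skew Y Z X hZ hX
  have e6 := symm X Y Z hX hY
  linarith

end LeviCivita

/-! ### Curves tangent to the distribution, vertical fields, local sections -/

section Leaves

variable {E : Type*} [NormedAddCommGroup E] [NormedSpace ℝ E]
  {M : Type*} [TopologicalSpace M] [ChartedSpace E M]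
  {E' : Type*} [NormedAddCommGroup E'] [NormedSpace ℝ E']
  {N : Type*} [TopologicalSpace N] [ChartedSpace E' N]
  {J : EndField E M} {ξ : VField E M}

omit [TopologicalSpace N] in
/-- A function whose derivative vanishes on `𝒟` along the fibres of a map constant on the leaves is
constant along curves tangent to `𝒟`. -/
theorem JoinedByTangentCurve.apply_eq {p : M → N}
    (hp : ∀ x y, JoinedByTangentCurve J ξ x y → p x = p y) {x y : M}
    (hxy : JoinedByTangentCurve J ξ x y) {φ : M → ℝ}
    (hφ : ∀ z, p z = p x → MDifferentiableAt 𝓘(ℝ, E) 𝓘(ℝ, ℝ) φ z)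
    (hφ' : ∀ z, p z = p x → ∀ v ∈ leafDist J ξ z, mvfderiv 𝓘(ℝ, E) φ z v = 0) : φ x = φ y := by
  obtain ⟨γ, a, b, hab, rfl, rfl, hγ⟩ := hxy
  have hpγ (t : ℝ) (ht : t ∈ Icc a b) : p (γ t) = p (γ a) := by
    refine (hp _ _ ⟨γ, a, t, ht.1, rfl, rfl, fun s hs ↦ ?_⟩).symm
    obtain ⟨v, hv, hd⟩ := hγ s ⟨hs.1, hs.2.trans ht.2⟩
    exact ⟨v, hv, hd.mono (Icc_subset_Icc_right ht.2)⟩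
  have hd (t : ℝ) (ht : t ∈ Icc a b) :
      HasFDerivWithinAt (φ ∘ γ) (0 : ℝ →L[ℝ] ℝ) (Icc a b) t := by
    obtain ⟨v, hv, hd⟩ := hγ t ht
    have h1 := (hφ _ (hpγ t ht)).hasMFDerivAt.comp_hasMFDerivWithinAt t hd
    have h2 : (mfderiv 𝓘(ℝ, E) 𝓘(ℝ, ℝ) φ (γ t)).comp
        ((1 : ℝ →L[ℝ] ℝ).smulRight (v : TangentSpace 𝓘(ℝ, E) (γ t))) = (0 : ℝ →L[ℝ] ℝ) := by
      refine ContinuousLinearMap.ext fun r ↦ ?_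
      have h3 : mfderiv 𝓘(ℝ, E) 𝓘(ℝ, ℝ) φ (γ t) v = (0 : ℝ) := hφ' _ (hpγ t ht) v hv
      change mfderiv 𝓘(ℝ, E) 𝓘(ℝ, ℝ) φ (γ t) (r • v) = (0 : ℝ)
      rw [map_smul, h3]
      exact smul_zero (A := ℝ) r
    exact (h1.congr_mfderiv h2).hasFDerivWithinAt
  have := (convex_Icc a b).norm_image_sub_le_of_norm_hasFDerivWithin_le (C := 0) hd
    (fun _ _ ↦ by simp) (left_mem_Icc.2 hab) (right_mem_Icc.2 hab)
  rw [zero_mul, norm_le_zero_iff, sub_eq_zero] at this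
  exact this.symm

/-- Vector fields tangent to `𝒟` are vertical for maps that are constant on the leaves. -/
theorem mfderiv_eq_zero_of_mem_leafDist [IsManifold 𝓘(ℝ, E) ∞ M] [CompleteSpace E] {p : M → N}
    (hp : ∀ x y, JoinedByTangentCurve J ξ x y → p x = p y)
    (hps : ContMDiff 𝓘(ℝ, E) 𝓘(ℝ, E') ∞ p) {ζ : VField E M} (hζ : SmoothVField ζ)
    (hζm : ∀ x, ζ x ∈ leafDist J ξ x) (x : M) :
    mfderiv 𝓘(ℝ, E) 𝓘(ℝ, E') p x (ζ x) = 0 := by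
  obtain ⟨γ, rfl, hγ⟩ := exists_isMIntegralCurveAt_of_contMDiffAt_boundaryless (t₀ := 0)
    (I := 𝓘(ℝ, E)) (v := ζ) ((hζ x).of_le (by simp))
  obtain ⟨r, hr, hball⟩ := Metric.eventually_nhds_iff.1 hγ
  have hd (t : ℝ) (ht : |t| < r) :
      HasMFDerivAt 𝓘(ℝ, ℝ) 𝓘(ℝ, E) γ t ((1 : ℝ →L[ℝ] ℝ).smulRight (ζ (γ t))) :=
    hball (by simpa using ht)
  -- An integral curve of `ζ` is itself a tangent curve. The sign of `t` decides which endpoint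
  -- comes first.
  have hconst : (p ∘ γ) =ᶠ[𝓝 0] fun _ ↦ p (γ 0) := by
    filter_upwards [Metric.ball_mem_nhds (0 : ℝ) hr] with t ht
    have ht' : |t| < r := by simpa using ht
    rcases le_total 0 t with h | h
    · refine (hp _ _ ⟨γ, 0, t, h, rfl, rfl, fun s hs ↦ ⟨_, hζm _, ?_⟩⟩).symm
      refine (hd s (lt_of_le_of_lt ?_ ht')).hasMFDerivWithinAt
      rw [abs_of_nonneg hs.1]
      exact hs.2.trans (le_abs_self t)
    · refine hp _ _ ⟨γ, t, 0, h, rfl, rfl, fun s hs ↦ ⟨_, hζm _, ?_⟩⟩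
      refine (hd s (lt_of_le_of_lt ?_ ht')).hasMFDerivWithinAt
      rw [abs_of_nonpos hs.2, abs_of_nonpos h]
      exact neg_le_neg hs.1
  have h1 := ((hps (γ 0)).mdifferentiableAt (by simp)).hasMFDerivAt.comp 0
    (hd 0 (by simpa using hr))
  have h2 := (hasMFDerivAt_const (I := 𝓘(ℝ, ℝ)) (I' := 𝓘(ℝ, E')) (p (γ 0)) (0 : ℝ))
  have h3 := congrArg (fun A : ℝ →L[ℝ] E' ↦ A 1)
    (hasMFDerivAt_unique h1 (h2.congr_of_eventuallyEq hconst))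
  have h4 : mfderiv 𝓘(ℝ, E) 𝓘(ℝ, E') p (γ 0) ((1 : ℝ) • ζ (γ 0)) = (0 : E') := h3
  rwa [one_smul] at h4

/-- Submersions have smooth local sections through every point. -/
theorem exists_local_section {p : M → N} (hp : Manifold.IsSubmersion 𝓘(ℝ, E) 𝓘(ℝ, E') ∞ p)
    (x : M) : ∃ s : N → M, ContMDiffAt 𝓘(ℝ, E') 𝓘(ℝ, E) ∞ s (p x) ∧ s (p x) = x ∧
      ∀ᶠ y in 𝓝 (p x), p (s y) = y := by
  obtain ⟨F, _, _, h⟩ := hp.isSubmersionAt x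
  have hx : h.domChart x ∈ h.domChart.target := h.domChart.map_source h.mem_domChart_source
  have hw (z : E) (hz : z ∈ h.domChart.target) :
      h.codChart (p (h.domChart.symm z)) = (h.equiv z).1 :=
    h.writtenInCharts (by simpa using hz)
  -- In the normal form `p` is a projection; the section freezes the fibre coordinate at its value
  -- at `x`.
  set k : E' → E := fun u ↦ h.equiv.symm (u, (h.equiv (h.domChart x)).2) with hk
  have hkx : k (h.codChart (p x)) = h.domChart x := by
    have := hw _ hx
    rw [h.domChart.left_inv h.mem_domChart_source] at this
    rw [hk, this]
    simp
  have hψ : ContMDiffAt 𝓘(ℝ, E') 𝓘(ℝ, E') ∞ h.codChart (p x) :=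
    contMDiffAt_of_mem_maximalAtlas h.codChart_mem_maximalAtlas h.mem_codChart_source
  have hks : ContDiff ℝ ∞ k := by fun_prop
  have hkψ : ContMDiffAt 𝓘(ℝ, E') 𝓘(ℝ, E) ∞ (k ∘ h.codChart) (p x) :=
    hks.contMDiff.contMDiffAt.comp _ hψ
  refine ⟨h.domChart.symm ∘ k ∘ h.codChart, ?_, ?_, ?_⟩
  · refine ContMDiffAt.comp (p x) ?_ hkψ
    refine contMDiffAt_symm_of_mem_maximalAtlas h.domChart_mem_maximalAtlas ?_
    rw [Function.comp_apply, hkx]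
    exact hx
  · rw [Function.comp_apply, Function.comp_apply, hkx, h.domChart.left_inv h.mem_domChart_source]
  · have h1 : ∀ᶠ y in 𝓝 (p x), (k ∘ h.codChart) y ∈ h.domChart.target := by
      refine hkψ.continuousAt.eventually (h.domChart.open_target.mem_nhds ?_)
      rw [Function.comp_apply, hkx]
      exact hx
    filter_upwards [h1, h.codChart.open_source.mem_nhds h.mem_codChart_source] with y hy hy'
    refine h.codChart.injOn
      (h.mapsto_domChart_source_codChart_source (h.domChart.map_target hy)) hy' ?_
    exact (hw _ hy).trans (by simp [hk])

end Leaves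

/-! ### Smoothness of tensor fields read in trivializations -/

section Coordinates

variable {E : Type*} [NormedAddCommGroup E] [NormedSpace ℝ E]
  {M : Type*} [TopologicalSpace M] [ChartedSpace E M] [IsManifold 𝓘(ℝ, E) ∞ M]

set_option synthInstance.maxHeartbeats 200000 in
theorem contDiff_flip {E F : Type*} [NormedAddCommGroup E] [NormedSpace ℝ E]
    [NormedAddCommGroup F] [NormedSpace ℝ F] :
    ContDiff ℝ ∞ (fun A : E →L[ℝ] F →L[ℝ] ℝ ↦ A.flip) := by
  have h : IsBoundedLinearMap ℝ (fun A : E →L[ℝ] F →L[ℝ] ℝ ↦ A.flip) :=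
    { map_add := fun _ _ ↦ rfl
      map_smul := fun _ _ ↦ rfl
      bound := ⟨1, one_pos, fun A ↦ by rw [ContinuousLinearMap.opNorm_flip, one_mul]⟩ }
  exact h.contDiff

/-- The inverse of the trivialization of the tangent bundle around `x₀`, at the point `x`. -/
def tangentFrame (x₀ x : M) : E →L[ℝ] TangentSpace 𝓘(ℝ, E) x :=
  (trivializationAt E (TangentSpace 𝓘(ℝ, E)) x₀).symmL ℝ x

/-- The trivialization of the tangent bundle around `x₀`, at the point `x`. -/
def tangentCoord (x₀ x : M) : TangentSpace 𝓘(ℝ, E) x →L[ℝ] E :=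
  (trivializationAt E (TangentSpace 𝓘(ℝ, E)) x₀).continuousLinearMapAt ℝ x

/-- The points where the trivialization of the tangent bundle around `x₀` is defined. -/
abbrev tangentBase (x₀ : M) : Set M := (trivializationAt E (TangentSpace 𝓘(ℝ, E)) x₀).baseSet

theorem tangentBase_mem_nhds (x₀ : M) : tangentBase (E := E) x₀ ∈ 𝓝 x₀ :=
  (trivializationAt E (TangentSpace 𝓘(ℝ, E)) x₀).open_baseSet.mem_nhds
    (FiberBundle.mem_baseSet_trivializationAt' x₀)

theorem tangentCoord_tangentFrame {x₀ x : M} (hx : x ∈ tangentBase (E := E) x₀) (v : E) :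
    tangentCoord x₀ x (tangentFrame x₀ x v) = v :=
  (trivializationAt E (TangentSpace 𝓘(ℝ, E)) x₀).continuousLinearMapAt_symmL hx v

theorem tangentFrame_tangentCoord {x₀ x : M} (hx : x ∈ tangentBase (E := E) x₀)
    (v : TangentSpace 𝓘(ℝ, E) x) : tangentFrame x₀ x (tangentCoord x₀ x v) = v :=
  (trivializationAt E (TangentSpace 𝓘(ℝ, E)) x₀).symmL_continuousLinearMapAt hx v

/-- A (0,2)-tensor field read in the trivialization around `x₀`. -/
def coordBilin (b : BilinField E M) (x₀ x : M) : E →L[ℝ] E →L[ℝ] ℝ :=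
  ContinuousLinearMap.bilinearComp (E := E) (F := E) (G := ℝ) (b x) (tangentFrame x₀ x)
    (tangentFrame x₀ x)

theorem coordBilin_apply (b : BilinField E M) (x₀ x : M) (v w : E) :
    coordBilin b x₀ x v w = b x (tangentFrame x₀ x v) (tangentFrame x₀ x w) := rfl

/-- On the base set, the hom-bundle coordinates are precomposition with the tangent frame in both
slots; agreement of germs at `x₀` is enough. -/
theorem contMDiffAt_bilinField_iff (b : BilinField E M) (x₀ : M) :
    ContMDiffAt 𝓘(ℝ, E) (𝓘(ℝ, E).prod 𝓘(ℝ, E →L[ℝ] E →L[ℝ] ℝ)) ∞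
      (fun x ↦ Bundle.TotalSpace.mk' (E →L[ℝ] E →L[ℝ] ℝ) x (b x)) x₀ ↔
    ContMDiffAt 𝓘(ℝ, E) 𝓘(ℝ, E →L[ℝ] E →L[ℝ] ℝ) ∞ (coordBilin b x₀) x₀ := by
  rw [contMDiffAt_hom_bundle]
  have h : (fun x ↦ ContinuousLinearMap.inCoordinates E (TangentSpace 𝓘(ℝ, E)) (E →L[ℝ] ℝ)
      (fun x : M ↦ TangentSpace 𝓘(ℝ, E) x →L[ℝ] Bundle.Trivial M ℝ x) x₀ x x₀ x (b x))
      =ᶠ[𝓝 x₀] coordBilin b x₀ := by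
    filter_upwards [tangentBase_mem_nhds (E := E) x₀] with x hx
    ext v w
    rw [inCoordinates_apply_eq₂ hx hx (mem_univ x),
      Bundle.Trivialization.coe_linearMapAt_of_mem _ (mem_univ x), coordBilin_apply, tangentFrame,
      Bundle.Trivialization.symmL_apply _ hx, Bundle.Trivialization.symmL_apply _ hx]
    rfl
  constructor
  · intro H
    exact H.2.congr_of_eventuallyEq h.symm
  · intro H
    exact ⟨contMDiffAt_id, H.congr_of_eventuallyEq h⟩

theorem contMDiffAt_vField_iff (X : VField E M) (x₀ : M) :
    ContMDiffAt 𝓘(ℝ, E) (𝓘(ℝ, E).prod 𝓘(ℝ, E)) ∞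
      (fun x ↦ Bundle.TotalSpace.mk' E x (X x)) x₀ ↔
    ContMDiffAt 𝓘(ℝ, E) 𝓘(ℝ, E) ∞ (fun x ↦ tangentCoord x₀ x (X x)) x₀ := by
  rw [Bundle.contMDiffAt_totalSpace]
  have h : (fun x ↦ (trivializationAt E (TangentSpace 𝓘(ℝ, E)) x₀
      (Bundle.TotalSpace.mk' E x (X x))).2) =ᶠ[𝓝 x₀] fun x ↦ tangentCoord x₀ x (X x) := by
    filter_upwards [tangentBase_mem_nhds (E := E) x₀] with x hx
    exact (congrFun ((trivializationAt E (TangentSpace 𝓘(ℝ, E)) x₀).coe_linearMapAt_of_mem (R := ℝ)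
      hx) (X x)).symm
  constructor
  · intro H
    exact H.2.congr_of_eventuallyEq h.symm
  · intro H
    exact ⟨contMDiffAt_id, H.congr_of_eventuallyEq h⟩

/-- The 1-form `b(·, X)` is smooth. -/
theorem contMDiffAt_rightContract_comp_tangentFrame {b : BilinField E M} {X : VField E M}
    (hb : SmoothBilinField b) (hX : SmoothVField X) (x₀ : M) :
    ContMDiffAt 𝓘(ℝ, E) 𝓘(ℝ, E →L[ℝ] ℝ) ∞
      (fun x ↦ ((rightContract b X x).comp (tangentFrame x₀ x) : E →L[ℝ] ℝ)) x₀ := by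
  have h1 := (contMDiffAt_bilinField_iff b x₀).1 (hb x₀)
  have h2 := (contMDiffAt_vField_iff X x₀).1 (hX x₀)
  -- The field is inserted in the second slot, hence the flip.
  have h3 : ContMDiffAt 𝓘(ℝ, E) 𝓘(ℝ, E →L[ℝ] E →L[ℝ] ℝ) ∞
      (fun x ↦ (coordBilin b x₀ x).flip) x₀ :=
    ContMDiffAt.comp (g := fun A : E →L[ℝ] E →L[ℝ] ℝ ↦ A.flip) x₀
      (contDiff_flip (E := E) (F := E)).contMDiff.contMDiffAt h1
  refine (h3.clm_apply h2).congr_of_eventuallyEq ?_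
  filter_upwards [tangentBase_mem_nhds (E := E) x₀] with x hx
  ext v
  change b x (tangentFrame x₀ x v) (X x) =
    b x (tangentFrame x₀ x v) (tangentFrame x₀ x (tangentCoord x₀ x (X x)))
  rw [tangentFrame_tangentCoord hx]

variable {E' : Type*} [NormedAddCommGroup E'] [NormedSpace ℝ E']
  {N : Type*} [TopologicalSpace N] [ChartedSpace E' N] [IsManifold 𝓘(ℝ, E') ∞ N]

theorem contMDiffAt_mfderiv_coord {p : M → N} (hp : ContMDiff 𝓘(ℝ, E) 𝓘(ℝ, E') ∞ p) (x₀ : M) :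
    ContMDiffAt 𝓘(ℝ, E) 𝓘(ℝ, E →L[ℝ] E') ∞ (fun x ↦ ((tangentCoord (p x₀) (p x)).comp
      ((mfderiv 𝓘(ℝ, E) 𝓘(ℝ, E') p x).comp (tangentFrame x₀ x)) : E →L[ℝ] E')) x₀ :=
  (hp x₀).mfderiv_const (m := ∞) (by simp)

end Coordinates

/-! ### The horizontal splitting and the algebra of horizontal lifts -/

section Submersion

variable {E : Type*} [NormedAddCommGroup E] [NormedSpace ℝ E] [FiniteDimensional ℝ E]
  {M : Type*} [TopologicalSpace M] [ChartedSpace E M] [IsManifold 𝓘(ℝ, E) ∞ M]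
  {E' : Type*} [NormedAddCommGroup E'] [NormedSpace ℝ E']
  {N : Type*} [TopologicalSpace N] [ChartedSpace E' N] [IsManifold 𝓘(ℝ, E') ∞ N]

/-- A holomorphic submersion `p : M → N` with fibres of dimension two from an `ε`-Kähler manifold
with a vector field `ξ` such that `Dξ = Id` and such that `ξ` and `Jξ` are vertical. -/
structure ConicalSubmersion (ε : ℝ) (J : EndField E M) (g : BilinField E M) (D : Connection E M)
    (ξ : VField E M) (p : M → N) (J' : EndField E' N) : Prop where
  eps_mul_eps : ε * ε = 1
  metric : IsPseudoRiemannian g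
  smooth_end : SmoothEndField J
  sq : ∀ x v, J x (J x v) = ε • v
  skew : ∀ x v w, g x (J x v) w = -g x v (J x w)
  leviCivita : IsLeviCivita g D
  parallel : ParallelEnd D J
  smooth_field : SmoothVField ξ
  cov_field : ∀ x v, D ξ x v = v
  ne_zero : ∀ x, g x (ξ x) (ξ x) ≠ 0
  holomorphic : IsHolomorphic J J' p
  smooth_end' : SmoothEndField J'
  sq' : ∀ y v, J' y (J' y v) = ε • v
  exists_section : ∀ x, ∃ s : N → M, ContMDiffAt 𝓘(ℝ, E') 𝓘(ℝ, E) ∞ s (p x) ∧ s (p x) = x ∧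
    ∀ᶠ y in 𝓝 (p x), p (s y) = y
  mfderiv_field : ∀ x, mfderiv 𝓘(ℝ, E) 𝓘(ℝ, E') p x (ξ x) = 0
  finrank_eq : Module.finrank ℝ E = Module.finrank ℝ E' + 2

/-- The map `v ↦ (dp v, g(v, ξ), g(v, Jξ))`. -/
def splitting (J : EndField E M) (g : BilinField E M) (ξ : VField E M) (p : M → N) (x : M) :
    TangentSpace 𝓘(ℝ, E) x →L[ℝ] TangentSpace 𝓘(ℝ, E') (p x) × ℝ × ℝ :=
  (mfderiv 𝓘(ℝ, E) 𝓘(ℝ, E') p x).prod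
    ((rightContract g ξ x).prod (rightContract g (fun y ↦ J y (ξ y)) x))

/-- The horizontal lift of tangent vectors, with respect to the orthogonal complement of
`span {ξ, Jξ}`. -/
def lift (J : EndField E M) (g : BilinField E M) (ξ : VField E M) (p : M → N) (x : M) :
    TangentSpace 𝓘(ℝ, E') (p x) →L[ℝ] TangentSpace 𝓘(ℝ, E) x :=
  (splitting J g ξ p x).inverse.comp (ContinuousLinearMap.inl ℝ _ (ℝ × ℝ))

/-- The horizontal lift of vector fields. -/
def liftField (J : EndField E M) (g : BilinField E M) (ξ : VField E M) (p : M → N)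
    (Y : VField E' N) : VField E M := fun x ↦ lift J g ξ p x (Y (p x))

omit [FiniteDimensional ℝ E] [IsManifold 𝓘(ℝ, E) ∞ M]
  [IsManifold 𝓘(ℝ, E') ∞ N] in
theorem splitting_apply (J : EndField E M) (g : BilinField E M) (ξ : VField E M) (p : M → N) (x : M)
    (v : TangentSpace 𝓘(ℝ, E) x) : splitting J g ξ p x v =
      (mfderiv 𝓘(ℝ, E) 𝓘(ℝ, E') p x v, g x v (ξ x), g x v (J x (ξ x))) := rfl

theorem isInvertible_of_injective {V W : Type*} [NormedAddCommGroup V] [NormedSpace ℝ V]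
    [FiniteDimensional ℝ V] [NormedAddCommGroup W] [NormedSpace ℝ W] [FiniteDimensional ℝ W]
    (h : Module.finrank ℝ V = Module.finrank ℝ W) {A : V →L[ℝ] W} (hA : Function.Injective A) :
    A.IsInvertible :=
  ⟨(LinearEquiv.ofInjectiveOfFinrankEq (A : V →ₗ[ℝ] W) hA h).toContinuousLinearEquiv, rfl⟩

namespace ConicalSubmersion

variable {ε : ℝ} {J : EndField E M} {g : BilinField E M} {D : Connection E M} {ξ : VField E M}
  {p : M → N} {J' : EndField E' N} (h : ConicalSubmersion ε J g D ξ p J')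
include h

theorem mdifferentiableAt (x : M) : MDifferentiableAt 𝓘(ℝ, E) 𝓘(ℝ, E') p x :=
  (h.holomorphic.smooth x).mdifferentiableAt (by simp)

theorem mfderiv_surjective (x : M) : Function.Surjective (mfderiv 𝓘(ℝ, E) 𝓘(ℝ, E') p x) := by
  obtain ⟨s, hs, hsx, hps⟩ := h.exists_section x
  intro a
  have h1 : HasMFDerivAt 𝓘(ℝ, E') 𝓘(ℝ, E') (p ∘ s) (p x) _ :=
    (h.mdifferentiableAt (s (p x))).hasMFDerivAt.comp (p x)
      (hs.mdifferentiableAt (by simp)).hasMFDerivAt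
  have h2 : HasMFDerivAt 𝓘(ℝ, E') 𝓘(ℝ, E') (p ∘ s) (p x) (ContinuousLinearMap.id ℝ _) :=
    (hasMFDerivAt_id (p x)).congr_of_eventuallyEq hps
  have h3 := congrArg (fun A : E' →L[ℝ] E' ↦ A a) (hasMFDerivAt_unique h1 h2)
  -- The derivative of a local section is a right inverse of `dp`, but based at `s (p x)`, which
  -- equals `x` only propositionally.
  have h4 (z : M) (hz : z = x) (u : TangentSpace 𝓘(ℝ, E) z)
      (hu : (mfderiv 𝓘(ℝ, E) 𝓘(ℝ, E') p z u : E') = a) :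
      ∃ u, mfderiv 𝓘(ℝ, E) 𝓘(ℝ, E') p x u = a := by
    subst hz
    exact ⟨u, hu⟩
  exact h4 _ hsx _ h3

theorem mfderiv_end_field (x : M) : mfderiv 𝓘(ℝ, E) 𝓘(ℝ, E') p x (J x (ξ x)) = 0 := by
  rw [h.holomorphic.comm, h.mfderiv_field, map_zero]

theorem metric_field_end (x : M) : g x (ξ x) (J x (ξ x)) = 0 := by
  have h1 := h.skew x (ξ x) (ξ x)
  rw [h.metric.symm x (J x (ξ x))] at h1
  linarith

theorem metric_end_end (x : M) (v w : TangentSpace 𝓘(ℝ, E) x) :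
    g x (J x v) (J x w) = -ε * g x v w := by
  rw [h.skew, h.sq, map_smul, smul_eq_mul, neg_mul]

theorem splitting_surjective (x : M) : Function.Surjective (splitting (E' := E') J g ξ p x) := by
  rintro ⟨a, r, s⟩
  obtain ⟨v, rfl⟩ := h.mfderiv_surjective x a
  have hf := h.ne_zero x
  have hε := h.eps_mul_eps
  -- Vertical corrections leave `dp v` alone. Since `g(Jξ, Jξ) = -ε g(ξ, ξ)` and `ε² = 1`, dividing
  -- by this norm gives the factor `-ε / g(ξ, ξ)`.
  refine ⟨v + ((r - g x v (ξ x)) / g x (ξ x) (ξ x)) • ξ x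
    - (ε * (s - g x v (J x (ξ x))) / g x (ξ x) (ξ x)) • J x (ξ x), ?_⟩
  rw [splitting_apply]
  simp only [map_add, map_sub, map_smul, add_apply, sub_apply, smul_apply, smul_eq_mul,
    h.mfderiv_field, h.mfderiv_end_field, h.metric_end_end, h.metric_field_end,
    h.metric.symm x (J x (ξ x)) (ξ x), smul_zero, add_zero, sub_zero]
  refine Prod.ext rfl (Prod.ext ?_ ?_)
  · change _ = r
    field_simp
    ring
  · change _ = s
    field_simp
    linear_combination ((s - g x v (J x (ξ x))) * g x (ξ x) (ξ x)) * hε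

variable [FiniteDimensional ℝ E']

theorem isInvertible_splitting (x : M) : (splitting (E' := E') J g ξ p x).IsInvertible := by
  have hfr : Module.finrank ℝ E = Module.finrank ℝ (E' × ℝ × ℝ) := by
    simp [h.finrank_eq]
  let A : E →L[ℝ] E' × ℝ × ℝ := splitting (E' := E') J g ξ p x
  exact isInvertible_of_injective hfr
    ((LinearMap.injective_iff_surjective_of_finrank_eq_finrank (f := A.toLinearMap) hfr).2
      (h.splitting_surjective x))

theorem splitting_lift (x : M) (a : TangentSpace 𝓘(ℝ, E') (p x)) :
    splitting J g ξ p x (lift J g ξ p x a) = (a, 0, 0) :=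
  IsInvertible.apply_inverse_apply (h.isInvertible_splitting x) _

theorem mfderiv_lift (x : M) (a : TangentSpace 𝓘(ℝ, E') (p x)) :
    mfderiv 𝓘(ℝ, E) 𝓘(ℝ, E') p x (lift J g ξ p x a) = a :=
  congrArg Prod.fst (h.splitting_lift x a)

theorem metric_lift_field (x : M) (a : TangentSpace 𝓘(ℝ, E') (p x)) :
    g x (lift J g ξ p x a) (ξ x) = 0 :=
  congrArg (fun u ↦ u.2.1) (h.splitting_lift x a)

theorem metric_lift_end_field (x : M) (a : TangentSpace 𝓘(ℝ, E') (p x)) :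
    g x (lift J g ξ p x a) (J x (ξ x)) = 0 :=
  congrArg (fun u ↦ u.2.2) (h.splitting_lift x a)

theorem splitting_injective (x : M) : Function.Injective (splitting (E' := E') J g ξ p x) := by
  obtain ⟨e, he⟩ := h.isInvertible_splitting x
  rw [← he]
  exact e.injective

theorem eq_lift {x : M} {v : TangentSpace 𝓘(ℝ, E) x} {a : TangentSpace 𝓘(ℝ, E') (p x)}
    (h1 : mfderiv 𝓘(ℝ, E) 𝓘(ℝ, E') p x v = a) (h2 : g x v (ξ x) = 0)
    (h3 : g x v (J x (ξ x)) = 0) : v = lift J g ξ p x a := by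
  refine h.splitting_injective x ?_
  rw [h.splitting_lift, splitting_apply, h1, h2, h3]

/-- Being skew with `J² = ε Id`, `J` preserves the span of `ξ, Jξ` and so its orthogonal complement;
holomorphy of `p` identifies the image below. -/
theorem end_lift (x : M) (a : TangentSpace 𝓘(ℝ, E') (p x)) :
    J x (lift J g ξ p x a) = lift J g ξ p x (J' (p x) a) := by
  refine h.eq_lift ?_ ?_ ?_
  · rw [h.holomorphic.comm, h.mfderiv_lift]
  · rw [h.skew, h.metric_lift_end_field, neg_zero]
  · rw [h.metric_end_end, h.metric_lift_field, mul_zero]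

/-- This is orthogonal projection off the basis `ξ, Jξ`, with square norms `g(ξ, ξ)` and `-ε g(ξ,
ξ)`. -/
theorem lift_mfderiv (x : M) (v : TangentSpace 𝓘(ℝ, E) x) :
    lift J g ξ p x (mfderiv 𝓘(ℝ, E) 𝓘(ℝ, E') p x v) =
      v - (g x v (ξ x) / g x (ξ x) (ξ x)) • ξ x
        + (ε * g x v (J x (ξ x)) / g x (ξ x) (ξ x)) • J x (ξ x) := by
  have hf := h.ne_zero x
  have hε := h.eps_mul_eps
  refine (h.eq_lift ?_ ?_ ?_).symm
  · simp [h.mfderiv_field, h.mfderiv_end_field]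
  · simp only [map_add, map_sub, map_smul, add_apply, sub_apply, smul_apply, smul_eq_mul,
      h.metric.symm x (J x (ξ x)) (ξ x), h.metric_field_end]
    field_simp
    ring
  · simp only [map_add, map_sub, map_smul, add_apply, sub_apply, smul_apply, smul_eq_mul,
      h.metric_end_end, h.metric_field_end]
    field_simp
    linear_combination (-g x v (J x (ξ x)) * g x (ξ x) (ξ x)) * hε

theorem metric_lift_mfderiv (x : M) (a : TangentSpace 𝓘(ℝ, E') (p x)) (w : TangentSpace 𝓘(ℝ, E) x) :
    g x (lift J g ξ p x a) (lift J g ξ p x (mfderiv 𝓘(ℝ, E) 𝓘(ℝ, E') p x w)) =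
      g x (lift J g ξ p x a) w := by
  rw [h.lift_mfderiv]
  simp only [map_add, map_sub, map_smul, smul_eq_mul, h.metric_lift_field,
    h.metric_lift_end_field, mul_zero, sub_zero, add_zero]

/-- The subtracted terms of `h` are exactly the contribution of the vertical parts to `g / g(ξ, ξ)`.
-/
theorem hTensor_eq (x : M) (v w : TangentSpace 𝓘(ℝ, E) x) :
    hTensor ε J g ξ x v w = g x (lift J g ξ p x (mfderiv 𝓘(ℝ, E) 𝓘(ℝ, E') p x v))
      (lift J g ξ p x (mfderiv 𝓘(ℝ, E) 𝓘(ℝ, E') p x w)) / g x (ξ x) (ξ x) := by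
  have hf := h.ne_zero x
  rw [h.metric_lift_mfderiv, h.lift_mfderiv, hTensor_apply]
  simp only [map_add, map_sub, map_smul, add_apply, sub_apply, smul_apply, smul_eq_mul,
    h.metric.symm x (ξ x) w, h.metric.symm x (J x (ξ x)) w]
  field_simp
  ring

end ConicalSubmersion

end Submersion

/-! ### Smooth dependence of the horizontal lift on the base point -/

section SmoothLift

variable {E : Type*} [NormedAddCommGroup E] [NormedSpace ℝ E] [FiniteDimensional ℝ E]
  {M : Type*} [TopologicalSpace M] [ChartedSpace E M] [IsManifold 𝓘(ℝ, E) ∞ M]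
  {E' : Type*} [NormedAddCommGroup E'] [NormedSpace ℝ E']
  {N : Type*} [TopologicalSpace N] [ChartedSpace E' N] [IsManifold 𝓘(ℝ, E') ∞ N]

/-- The map `splitting` read in the trivializations around `x₀` and `p x₀`. -/
def splittingCoord (J : EndField E M) (g : BilinField E M) (ξ : VField E M) (p : M → N)
    (x₀ x : M) : E →L[ℝ] E' × ℝ × ℝ :=
  ((tangentCoord (p x₀) (p x)).comp
      ((mfderiv 𝓘(ℝ, E) 𝓘(ℝ, E') p x).comp (tangentFrame x₀ x)) : E →L[ℝ] E').prod
    (((rightContract g ξ x).comp (tangentFrame x₀ x) : E →L[ℝ] ℝ).prod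
      ((rightContract g (fun y ↦ J y (ξ y)) x).comp (tangentFrame x₀ x) : E →L[ℝ] ℝ))

/-- The horizontal lift read in the trivializations around `x₀` and `p x₀`. -/
def liftCoord (J : EndField E M) (g : BilinField E M) (ξ : VField E M) (p : M → N)
    (x₀ x : M) : E' →L[ℝ] E :=
  (tangentCoord x₀ x).comp ((lift J g ξ p x).comp (tangentFrame (p x₀) (p x)))

omit [FiniteDimensional ℝ E] [IsManifold 𝓘(ℝ, E) ∞ M] in
theorem contMDiffAt_clm_prod {F F₁ F₂ : Type*} [NormedAddCommGroup F] [NormedSpace ℝ F]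
    [NormedAddCommGroup F₁] [NormedSpace ℝ F₁] [NormedAddCommGroup F₂] [NormedSpace ℝ F₂]
    {A : M → F →L[ℝ] F₁} {B : M → F →L[ℝ] F₂} {x : M}
    (hA : ContMDiffAt 𝓘(ℝ, E) 𝓘(ℝ, F →L[ℝ] F₁) ∞ A x)
    (hB : ContMDiffAt 𝓘(ℝ, E) 𝓘(ℝ, F →L[ℝ] F₂) ∞ B x) :
    ContMDiffAt 𝓘(ℝ, E) 𝓘(ℝ, F →L[ℝ] F₁ × F₂) ∞ (fun y ↦ (A y).prod (B y)) x := by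
  have h1 : ContMDiffAt 𝓘(ℝ, E) 𝓘(ℝ, F →L[ℝ] F₁ × F₂) ∞
      (fun y ↦ (ContinuousLinearMap.inl ℝ F₁ F₂).comp (A y)) x := contMDiffAt_const.clm_comp hA
  have h2 : ContMDiffAt 𝓘(ℝ, E) 𝓘(ℝ, F →L[ℝ] F₁ × F₂) ∞
      (fun y ↦ (ContinuousLinearMap.inr ℝ F₁ F₂).comp (B y)) x := contMDiffAt_const.clm_comp hB
  refine (h1.add h2).congr_of_eventuallyEq (Eventually.of_forall fun y ↦ ?_)
  ext v <;> simp

namespace ConicalSubmersion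

variable {ε : ℝ} {J : EndField E M} {g : BilinField E M} {D : Connection E M} {ξ : VField E M}
  {p : M → N} {J' : EndField E' N} (h : ConicalSubmersion ε J g D ξ p J')
include h

theorem contMDiffAt_splittingCoord (x₀ : M) : ContMDiffAt 𝓘(ℝ, E) 𝓘(ℝ, E →L[ℝ] E' × ℝ × ℝ) ∞
    (splittingCoord (E' := E') J g ξ p x₀) x₀ :=
  contMDiffAt_clm_prod (contMDiffAt_mfderiv_coord h.holomorphic.smooth x₀)
    (contMDiffAt_clm_prod
      (contMDiffAt_rightContract_comp_tangentFrame h.metric.smooth h.smooth_field x₀)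
      (contMDiffAt_rightContract_comp_tangentFrame h.metric.smooth
        (h.smooth_end.smoothVField_apply h.smooth_field) x₀))

theorem eventually_tangentBase (x₀ : M) :
    ∀ᶠ x in 𝓝 x₀, x ∈ tangentBase (E := E) x₀ ∧ p x ∈ tangentBase (E := E') (p x₀) :=
  Filter.Eventually.and (tangentBase_mem_nhds x₀)
    ((h.holomorphic.smooth x₀).continuousAt.eventually (tangentBase_mem_nhds (p x₀)))

variable [FiniteDimensional ℝ E']

theorem isInvertible_splittingCoord {x₀ x : M} (hx : x ∈ tangentBase (E := E) x₀)
    (hpx : p x ∈ tangentBase (E := E') (p x₀)) :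
    (splittingCoord (E' := E') J g ξ p x₀ x).IsInvertible := by
  refine isInvertible_of_injective (by simp [h.finrank_eq]) ?_
  refine (injective_iff_map_eq_zero _).2 fun v hv ↦ ?_
  have h1 : tangentCoord (p x₀) (p x)
      (mfderiv 𝓘(ℝ, E) 𝓘(ℝ, E') p x (tangentFrame x₀ x v)) = 0 := congrArg Prod.fst hv
  have h2 : splitting (E' := E') J g ξ p x (tangentFrame x₀ x v) = 0 := by
    have h2 : (splittingCoord (E' := E') J g ξ p x₀ x v).2 = 0 := by rw [hv]; rfl
    refine Prod.ext ?_ h2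
    change mfderiv 𝓘(ℝ, E) 𝓘(ℝ, E') p x (tangentFrame x₀ x v) = 0
    rw [← tangentFrame_tangentCoord hpx (mfderiv 𝓘(ℝ, E) 𝓘(ℝ, E') p x (tangentFrame x₀ x v)), h1,
      map_zero]
  have h3 : tangentFrame x₀ x v = 0 := h.splitting_injective x (h2.trans (map_zero _).symm)
  rw [← tangentCoord_tangentFrame hx v, h3, map_zero]

/-- Exhibits the lift through the inverse of a smooth family of invertible operators; smoothness of
operator inversion then applies. -/
theorem liftCoord_eq {x₀ x : M} (hx : x ∈ tangentBase (E := E) x₀)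
    (hpx : p x ∈ tangentBase (E := E') (p x₀)) : liftCoord (E' := E') J g ξ p x₀ x =
      (splittingCoord J g ξ p x₀ x).inverse.comp (ContinuousLinearMap.inl ℝ E' (ℝ × ℝ)) := by
  ext a
  rw [ContinuousLinearMap.comp_apply, eq_comm,
    (h.isInvertible_splittingCoord hx hpx).inverse_apply_eq]
  have e : tangentFrame x₀ x (liftCoord J g ξ p x₀ x a) =
      lift J g ξ p x (tangentFrame (p x₀) (p x) a) :=
    tangentFrame_tangentCoord hx _
  refine Prod.ext ?_ (Prod.ext ?_ ?_)
  · change a = tangentCoord (p x₀) (p x) (mfderiv 𝓘(ℝ, E) 𝓘(ℝ, E') p x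
      (tangentFrame x₀ x (liftCoord J g ξ p x₀ x a)))
    rw [e, h.mfderiv_lift, tangentCoord_tangentFrame hpx]
  · change 0 = g x (tangentFrame x₀ x (liftCoord J g ξ p x₀ x a)) (ξ x)
    rw [e, h.metric_lift_field]
  · change 0 = g x (tangentFrame x₀ x (liftCoord J g ξ p x₀ x a)) (J x (ξ x))
    rw [e, h.metric_lift_end_field]

theorem contMDiffAt_liftCoord (x₀ : M) :
    ContMDiffAt 𝓘(ℝ, E) 𝓘(ℝ, E' →L[ℝ] E) ∞ (liftCoord (E' := E') J g ξ p x₀) x₀ := by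
  have hx₀ := (h.eventually_tangentBase x₀).self_of_nhds
  have h1 : ContMDiffAt 𝓘(ℝ, E) 𝓘(ℝ, E' × ℝ × ℝ →L[ℝ] E) ∞
      (fun x ↦ (splittingCoord (E' := E') J g ξ p x₀ x).inverse) x₀ :=
    ContMDiffAt.comp (I' := 𝓘(ℝ, E →L[ℝ] E' × ℝ × ℝ)) x₀
      (h.isInvertible_splittingCoord hx₀.1 hx₀.2).contDiffAt_map_inverse.contMDiffAt
      (h.contMDiffAt_splittingCoord x₀)
  refine (h1.clm_comp (contMDiffAt_const
    (c := ContinuousLinearMap.inl ℝ E' (ℝ × ℝ)))).congr_of_eventuallyEq ?_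
  filter_upwards [h.eventually_tangentBase x₀] with x hx
  exact h.liftCoord_eq hx.1 hx.2

theorem diffVFieldAt_liftField {Y : VField E' N} {x : M} (hY : DiffVFieldAt Y (p x)) :
    DiffVFieldAt (liftField J g ξ p Y) x :=
  MDifferentiableAt.clm_apply_of_inCoordinates (b₁ := p) (b₂ := id)
    (ϕ := fun m ↦ lift J g ξ p m)
    ((h.contMDiffAt_liftCoord x).mdifferentiableAt (by simp))
    (hY.comp x (h.mdifferentiableAt x)) mdifferentiableAt_id

end ConicalSubmersion

end SmoothLift

/-! ### Constancy of the horizontal form along leaves -/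

section Descent

variable {E : Type*} [NormedAddCommGroup E] [NormedSpace ℝ E]
  {M : Type*} [TopologicalSpace M] [ChartedSpace E M] [IsManifold 𝓘(ℝ, E) ∞ M]

theorem SmoothBilinField.contMDiffAt_apply {b : BilinField E M} (hb : SmoothBilinField b)
    {Y Z : VField E M} (hY : SmoothVField Y) (hZ : SmoothVField Z) (x : M) :
    ContMDiffAt 𝓘(ℝ, E) 𝓘(ℝ, ℝ) ∞ (fun y ↦ b y (Y y) (Z y)) x := by
  have : ContMDiffAt 𝓘(ℝ, E) (𝓘(ℝ, E).prod 𝓘(ℝ, ℝ)) ∞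
      (fun m ↦ Bundle.TotalSpace.mk' ℝ (E := Bundle.Trivial M ℝ) m (b m (Y m) (Z m))) x :=
    ContMDiffAt.clm_bundle_apply₂ (F₁ := E) (F₂ := E) (hb x) (hY x) (hZ x)
  rw [Bundle.contMDiffAt_totalSpace] at this
  exact this.2

variable [FiniteDimensional ℝ E]
  {E' : Type*} [NormedAddCommGroup E'] [NormedSpace ℝ E']
  {N : Type*} [TopologicalSpace N] [ChartedSpace E' N] [IsManifold 𝓘(ℝ, E') ∞ N]

/-- The bilinear form on `T_{p x} N` induced by `g / g(ξ, ξ)` on the horizontal space at `x`. -/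
def fibreForm (J : EndField E M) (g : BilinField E M) (ξ : VField E M) (p : M → N) (x : M) :
    TangentSpace 𝓘(ℝ, E') (p x) →L[ℝ] TangentSpace 𝓘(ℝ, E') (p x) →L[ℝ] ℝ :=
  letI L : E' →L[ℝ] E := lift (E' := E') J g ξ p x
  letI b : E →L[ℝ] E →L[ℝ] ℝ := g x
  ((g x (ξ x) (ξ x))⁻¹ • b.bilinearComp L L : E' →L[ℝ] E' →L[ℝ] ℝ)

omit [IsManifold 𝓘(ℝ, E) ∞ M] [IsManifold 𝓘(ℝ, E') ∞ N] [FiniteDimensional ℝ E] in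
theorem fibreForm_apply (J : EndField E M) (g : BilinField E M) (ξ : VField E M) (p : M → N) (x : M)
    (a b : TangentSpace 𝓘(ℝ, E') (p x)) : fibreForm J g ξ p x a b =
      (g x (ξ x) (ξ x))⁻¹ * g x (lift J g ξ p x a) (lift J g ξ p x b) := rfl

namespace ConicalSubmersion

variable {ε : ℝ} {J : EndField E M} {g : BilinField E M} {D : Connection E M} {ξ : VField E M}
  {p : M → N} {J' : EndField E' N} (h : ConicalSubmersion ε J g D ξ p J')
include h

theorem mvfderiv_metric_field (x : M) (v : TangentSpace 𝓘(ℝ, E) x) :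
    mvfderiv 𝓘(ℝ, E) (fun y ↦ g y (ξ y) (ξ y)) x v = 2 * g x v (ξ x) := by
  rw [h.leviCivita.metric.mvfderiv_apply (h.smooth_field.diffVFieldAt x)
    (h.smooth_field.diffVFieldAt x), h.cov_field, h.metric.symm x (ξ x) v]
  ring

variable [FiniteDimensional ℝ E']

theorem metric_lift_vertical {x : M} (a : TangentSpace 𝓘(ℝ, E') (p x))
    {w : TangentSpace 𝓘(ℝ, E) x} (hw : mfderiv 𝓘(ℝ, E) 𝓘(ℝ, E') p x w = 0) :
    g x (lift J g ξ p x a) w = 0 := by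
  rw [← h.metric_lift_mfderiv, hw, map_zero, map_zero]

/-- Up to a vertical vector, the derivative of a horizontal lift along a vertical vector field `ζ`
is the derivative of `ζ` along the lift. -/
theorem metric_cov_liftField {ζ : VField E M} (hζ : SmoothVField ζ)
    (hζv : ∀ x, mfderiv 𝓘(ℝ, E) 𝓘(ℝ, E') p x (ζ x) = 0) {A : VField E' N} {x : M}
    (hA : DiffVFieldAt A (p x)) (b : TangentSpace 𝓘(ℝ, E') (p x)) :
    g x (lift J g ξ p x b) (D (liftField J g ξ p A) x (ζ x)) =
      g x (lift J g ξ p x b) (D ζ x (lift J g ξ p x (A (p x)))) := by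
  have h1 := h.leviCivita.sub_eq_mlieBracket (hζ.diffVFieldAt x) (h.diffVFieldAt_liftField hA)
  -- The field `ζ` is `p`-related to zero and the lift to `A`, so their bracket is vertical.
  have h2 : mfderiv 𝓘(ℝ, E) 𝓘(ℝ, E') p x
      (mlieBracket 𝓘(ℝ, E) ζ (liftField J g ξ p A) x) = 0 := by
    rw [mfderiv_mlieBracket_of_related (V' := 0) (W' := A) h.holomorphic.smooth
      (hζ.diffVFieldAt x) (h.diffVFieldAt_liftField hA) (Bundle.mdifferentiableAt_zeroSection ℝ _) hA hζv
      (fun y ↦ h.mfderiv_lift y _), mlieBracket_zero_left]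
    rfl
  have h3 := h.metric_lift_vertical b h2
  rw [← h1, map_sub, sub_eq_zero] at h3
  exact h3

theorem mdifferentiableAt_fibreForm {A B : VField E' N} {x : M} (hA : DiffVFieldAt A (p x))
    (hB : DiffVFieldAt B (p x)) : MDifferentiableAt 𝓘(ℝ, E) 𝓘(ℝ, ℝ)
      (fun y ↦ fibreForm J g ξ p y (A (p y)) (B (p y))) x := by
  have h1 := h.metric.smooth.mdifferentiableAt_apply (h.diffVFieldAt_liftField hA)
    (h.diffVFieldAt_liftField hB)
  have h2 := h.metric.smooth.mdifferentiableAt_apply (h.smooth_field.diffVFieldAt x)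
    (h.smooth_field.diffVFieldAt x)
  exact ((differentiableAt_inv (h.ne_zero x)).mdifferentiableAt.comp x h2).mul h1

/-- The product rule for `g(ξ, ξ)` times the form, which is `g` of the two lifts; this avoids
differentiating the inverse. -/
theorem mvfderiv_fibreForm {A B : VField E' N} {x : M} (hA : DiffVFieldAt A (p x))
    (hB : DiffVFieldAt B (p x)) (v : TangentSpace 𝓘(ℝ, E) x) :
    g x (ξ x) (ξ x) * mvfderiv 𝓘(ℝ, E) (fun y ↦ fibreForm J g ξ p y (A (p y)) (B (p y))) x v =
      g x (D (liftField J g ξ p A) x v) (lift J g ξ p x (B (p x))) +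
        g x (lift J g ξ p x (A (p x))) (D (liftField J g ξ p B) x v) -
        2 * g x v (ξ x) * fibreForm J g ξ p x (A (p x)) (B (p x)) := by
  have h1 := h.leviCivita.metric.mvfderiv_apply (h.diffVFieldAt_liftField hA)
    (h.diffVFieldAt_liftField hB) v
  have h2 := h.metric.smooth.mdifferentiableAt_apply (h.smooth_field.diffVFieldAt x)
    (h.smooth_field.diffVFieldAt x)
  have h3 : (fun y ↦ g y (liftField J g ξ p A y) (liftField J g ξ p B y)) =
      (fun y ↦ g y (ξ y) (ξ y)) * fun y ↦ fibreForm J g ξ p y (A (p y)) (B (p y)) := by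
    funext y
    rw [Pi.mul_apply, fibreForm_apply, mul_inv_cancel_left₀ (h.ne_zero y)]
    rfl
  rw [h3, mvfderiv_mul h2 (h.mdifferentiableAt_fibreForm hA hB), add_apply, smul_apply, smul_apply,
    h.mvfderiv_metric_field, smul_eq_mul, smul_eq_mul] at h1
  change _ = g x (D (liftField J g ξ p A) x v) (liftField J g ξ p B x) +
    g x (liftField J g ξ p A x) (D (liftField J g ξ p B) x v) - _
  rw [← h1]
  ring

theorem mvfderiv_fibreForm_eq_zero {A B : VField E' N} {x : M} (hA : DiffVFieldAt A (p x))
    (hB : DiffVFieldAt B (p x)) {v : TangentSpace 𝓘(ℝ, E) x} (hv : v ∈ leafDist J ξ x) :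
    mvfderiv 𝓘(ℝ, E) (fun y ↦ fibreForm J g ξ p y (A (p y)) (B (p y))) x v = 0 := by
  have hf := h.ne_zero x
  obtain ⟨r, s, rfl⟩ := Submodule.mem_span_pair.1 hv
  -- Along `ξ`, `Dξ = Id` makes the first two terms add to twice `g` of the lifts, which the
  -- derivative of `g(ξ, ξ)` cancels.
  have h1 : mvfderiv 𝓘(ℝ, E) (fun y ↦ fibreForm J g ξ p y (A (p y)) (B (p y))) x (ξ x) = 0 := by
    refine (mul_eq_zero_iff_left hf).1 ?_
    rw [h.mvfderiv_fibreForm hA hB, h.metric.symm x (D _ x _),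
      h.metric_cov_liftField h.smooth_field h.mfderiv_field hA,
      h.metric_cov_liftField h.smooth_field h.mfderiv_field hB, h.cov_field, h.cov_field,
      h.metric.symm x (lift J g ξ p x (B (p x))), fibreForm_apply]
    field_simp
    ring
  -- Along `Jξ`, `D(Jξ) = J` makes the first two terms cancel by skewness, and `g(Jξ, ξ) = 0` kills
  -- the third.
  have h2 : mvfderiv 𝓘(ℝ, E) (fun y ↦ fibreForm J g ξ p y (A (p y)) (B (p y))) x
      (J x (ξ x)) = 0 := by
    refine (mul_eq_zero_iff_left hf).1 ?_
    have hJξ := h.smooth_end.smoothVField_apply h.smooth_field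
    rw [h.mvfderiv_fibreForm hA hB, h.metric.symm x (D _ x _),
      h.metric_cov_liftField hJξ h.mfderiv_end_field hA,
      h.metric_cov_liftField hJξ h.mfderiv_end_field hB,
      h.parallel.covariantDerivative_apply (h.smooth_field.diffVFieldAt x),
      h.parallel.covariantDerivative_apply (h.smooth_field.diffVFieldAt x), h.cov_field,
      h.cov_field, h.metric.symm x (lift J g ξ p x (B (p x))), h.skew, h.metric.symm x (J x (ξ x)),
      h.metric_field_end]
    ring
  rw [map_add, map_smul, map_smul, h1, h2, smul_zero, smul_zero, add_zero]

theorem fibreForm_eq_of_joined (hp : ∀ x y, JoinedByTangentCurve J ξ x y → p x = p y)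
    {A B : VField E' N} {x y : M} (hA : DiffVFieldAt A (p x)) (hB : DiffVFieldAt B (p x))
    (hxy : Relation.EqvGen (JoinedByTangentCurve J ξ) x y) :
    fibreForm J g ξ p x (A (p x)) (B (p x)) = fibreForm J g ξ p y (A (p y)) (B (p y)) := by
  have hpe {x y : M} (hxy : Relation.EqvGen (JoinedByTangentCurve J ξ) x y) : p x = p y := by
    induction hxy with
    | rel x y hxy => exact hp x y hxy
    | refl x => rfl
    | symm x y _ ih => exact ih.symm
    | trans x y z _ _ ih1 ih2 => exact ih1.trans ih2
  induction hxy with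
  | rel x y hxy =>
    refine hxy.apply_eq (φ := fun x ↦ fibreForm J g ξ p x (A (p x)) (B (p x))) hp ?_ ?_
    · intro z hz
      exact h.mdifferentiableAt_fibreForm (hz ▸ hA) (hz ▸ hB)
    · intro z hz v hv
      exact h.mvfderiv_fibreForm_eq_zero (hz ▸ hA) (hz ▸ hB) hv
  | refl x => rfl
  | symm x y hxy ih => exact (ih (hpe hxy ▸ hA) (hpe hxy ▸ hB)).symm
  | trans x y z hxy _ ih1 ih2 =>
    exact (ih1 hA hB).trans (ih2 (hpe hxy ▸ hA) (hpe hxy ▸ hB))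

end ConicalSubmersion

end Descent

/-! ### The metric on the quotient -/

section QuotientMetric

variable {E : Type*} [NormedAddCommGroup E] [NormedSpace ℝ E] [FiniteDimensional ℝ E]
  {M : Type*} [TopologicalSpace M] [ChartedSpace E M] [IsManifold 𝓘(ℝ, E) ∞ M]
  {E' : Type*} [NormedAddCommGroup E'] [NormedSpace ℝ E'] [FiniteDimensional ℝ E']
  {N : Type*} [TopologicalSpace N] [ChartedSpace E' N] [IsManifold 𝓘(ℝ, E') ∞ N]

omit [FiniteDimensional ℝ E] [FiniteDimensional ℝ E'] [IsManifold 𝓘(ℝ, E) ∞ M] in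
theorem contMDiffAt_bilinearComp {B : M → E →L[ℝ] E →L[ℝ] ℝ} {L : M → E' →L[ℝ] E} {x : M}
    (hB : ContMDiffAt 𝓘(ℝ, E) 𝓘(ℝ, E →L[ℝ] E →L[ℝ] ℝ) ∞ B x)
    (hL : ContMDiffAt 𝓘(ℝ, E) 𝓘(ℝ, E' →L[ℝ] E) ∞ L x) :
    ContMDiffAt 𝓘(ℝ, E) 𝓘(ℝ, E' →L[ℝ] E' →L[ℝ] ℝ) ∞
      (fun y ↦ (B y).bilinearComp (L y) (L y)) x := by
  have h1 : ContMDiffAt 𝓘(ℝ, E) 𝓘(ℝ, E →L[ℝ] E' →L[ℝ] ℝ) ∞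
      (fun y ↦ ((B y).comp (L y)).flip) x :=
    ContMDiffAt.comp (g := fun A : E' →L[ℝ] E →L[ℝ] ℝ ↦ A.flip) x
      (contDiff_flip (E := E') (F := E)).contMDiff.contMDiffAt (hB.clm_comp hL)
  exact ContMDiffAt.comp (g := fun A : E' →L[ℝ] E' →L[ℝ] ℝ ↦ A.flip) x
    (contDiff_flip (E := E') (F := E')).contMDiff.contMDiffAt (h1.clm_comp hL)

namespace ConicalSubmersion

variable {ε : ℝ} {J : EndField E M} {g : BilinField E M} {D : Connection E M} {ξ : VField E M}
  {p : M → N} {J' : EndField E' N} (h : ConicalSubmersion ε J g D ξ p J')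
include h

theorem exists_bilinField_eq_fibreForm (hp : ∀ x y, JoinedByTangentCurve J ξ x y → p x = p y)
    (hp' : ∀ x y, p x = p y → Relation.EqvGen (JoinedByTangentCurve J ξ) x y)
    (hs : Function.Surjective p) :
    ∃ g' : BilinField E' N, ∀ x, g' (p x) = fibreForm J g ξ p x := by
  have H (y : N) : ∃ b : TangentSpace 𝓘(ℝ, E') y →L[ℝ] TangentSpace 𝓘(ℝ, E') y →L[ℝ] ℝ,
      ∀ x (hx : p x = y), b = hx ▸ fibreForm J g ξ p x := by
    obtain ⟨z, rfl⟩ := hs y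
    refine ⟨fibreForm J g ξ p z, fun x hx ↦ ?_⟩
    ext a b
    obtain ⟨A, hA, rfl⟩ := exists_diffVFieldAt_eq a
    obtain ⟨B, hB, rfl⟩ := exists_diffVFieldAt_eq b
    rw [h.fibreForm_eq_of_joined hp hA hB (hp' _ _ hx.symm)]
    -- Both sides now agree up to the cast along `hx`, which can be eliminated once `p z` is a
    -- variable.
    generalize p z = y at hx
    subst hx
    rfl
  choose g' hg' using H
  exact ⟨g', fun x ↦ hg' _ x rfl⟩

variable {g' : BilinField E' N} (hg' : ∀ x, g' (p x) = fibreForm J g ξ p x)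
include hg'

omit [FiniteDimensional ℝ E] [IsManifold 𝓘(ℝ, E) ∞ M] [FiniteDimensional ℝ E']
  [IsManifold 𝓘(ℝ, E') ∞ N] h in
theorem quotient_apply (x : M) (a b : TangentSpace 𝓘(ℝ, E') (p x)) : g' (p x) a b =
    (g x (ξ x) (ξ x))⁻¹ * g x (lift J g ξ p x a) (lift J g ξ p x b) := by
  rw [hg', fibreForm_apply]

theorem pullbackEq_quotient : PullbackEq p g' (hTensor ε J g ξ) := by
  intro x v w
  rw [quotient_apply hg', h.hTensor_eq, div_eq_inv_mul]

/-- Upstairs the coordinate form is built from `g` and the smooth lift; composing with a local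
section brings it down. -/
theorem contMDiffAt_quotient (x₀ : M) :
    ContMDiffAt 𝓘(ℝ, E') (𝓘(ℝ, E').prod 𝓘(ℝ, E' →L[ℝ] E' →L[ℝ] ℝ)) ∞
      (fun y ↦ Bundle.TotalSpace.mk' (E' →L[ℝ] E' →L[ℝ] ℝ) y (g' y)) (p x₀) := by
  rw [contMDiffAt_bilinField_iff]
  obtain ⟨s, hs, hsx, hps⟩ := h.exists_section x₀
  let G (x : M) : E' →L[ℝ] E' →L[ℝ] ℝ := (g x (ξ x) (ξ x))⁻¹ •
    (coordBilin g x₀ x).bilinearComp (liftCoord J g ξ p x₀ x) (liftCoord J g ξ p x₀ x)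
  have hG : ContMDiffAt 𝓘(ℝ, E) 𝓘(ℝ, E' →L[ℝ] E' →L[ℝ] ℝ) ∞ G x₀ := by
    have h1 : ContMDiffAt 𝓘(ℝ, E) 𝓘(ℝ, ℝ) ∞ (fun x ↦ (g x (ξ x) (ξ x))⁻¹) x₀ :=
      (contDiffAt_inv ℝ (h.ne_zero x₀)).contMDiffAt.comp x₀
        (h.metric.smooth.contMDiffAt_apply h.smooth_field h.smooth_field x₀)
    exact h1.smul (contMDiffAt_bilinearComp
      ((contMDiffAt_bilinField_iff g x₀).1 (h.metric.smooth x₀)) (h.contMDiffAt_liftCoord x₀))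
  have hGg : ∀ᶠ x in 𝓝 x₀, coordBilin g' (p x₀) (p x) = G x := by
    filter_upwards [h.eventually_tangentBase x₀] with x hx
    have e (u : E') : tangentFrame x₀ x (liftCoord J g ξ p x₀ x u) =
        lift J g ξ p x (tangentFrame (p x₀) (p x) u) := tangentFrame_tangentCoord hx.1 _
    ext u v
    rw [coordBilin_apply, quotient_apply hg', ← e, ← e]
    rfl
  have hGs : ContMDiffAt 𝓘(ℝ, E') 𝓘(ℝ, E' →L[ℝ] E' →L[ℝ] ℝ) ∞ (G ∘ s) (p x₀) :=
    ContMDiffAt.comp (I' := 𝓘(ℝ, E)) (p x₀) (by rwa [hsx]) hs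
  refine hGs.congr_of_eventuallyEq ?_
  have hs' : Tendsto s (𝓝 (p x₀)) (𝓝 x₀) := by
    simpa only [ContinuousAt, hsx] using hs.continuousAt
  filter_upwards [hs'.eventually hGg, hps] with y hy hpy
  rw [Function.comp_apply, ← hy, hpy]

variable (hs : Function.Surjective p)
include hs

theorem isPseudoRiemannian_quotient : IsPseudoRiemannian g' where
  smooth y := by
    obtain ⟨x, rfl⟩ := hs y
    exact h.contMDiffAt_quotient hg' x
  symm y a b := by
    obtain ⟨x, rfl⟩ := hs y
    rw [quotient_apply hg', quotient_apply hg', h.metric.symm x (lift J g ξ p x a)]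
  nondegenerate y a ha := by
    obtain ⟨x, rfl⟩ := hs y
    have h1 : lift J g ξ p x a = 0 := by
      -- A lift pairs with `w` only through the horizontal part of `w`, that is through `dp w`.
      refine h.metric.nondegenerate x _ fun w ↦ ?_
      have := ha (mfderiv 𝓘(ℝ, E) 𝓘(ℝ, E') p x w)
      rw [quotient_apply hg', h.metric_lift_mfderiv] at this
      exact (mul_eq_zero_iff_left (inv_ne_zero (h.ne_zero x))).1 this
    rw [← h.mfderiv_lift x a, h1, map_zero]

theorem skew_quotient (y : N) (a b : TangentSpace 𝓘(ℝ, E') y) :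
    g' y (J' y a) b = -g' y a (J' y b) := by
  obtain ⟨x, rfl⟩ := hs y
  rw [quotient_apply hg', quotient_apply hg', ← h.end_lift, ← h.end_lift, h.skew, mul_neg]

theorem eq_quotient {g'' : BilinField E' N} (hg'' : PullbackEq p g'' (hTensor ε J g ξ)) :
    g'' = g' := by
  funext y
  obtain ⟨x, rfl⟩ := hs y
  ext a b
  obtain ⟨v, rfl⟩ := h.mfderiv_surjective x a
  obtain ⟨w, rfl⟩ := h.mfderiv_surjective x b
  rw [hg'', h.pullbackEq_quotient hg']

end ConicalSubmersion

end QuotientMetric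

/-! ### The Levi-Civita connection of the quotient -/

section QuotientConnection

variable {E : Type*} [NormedAddCommGroup E] [NormedSpace ℝ E] [FiniteDimensional ℝ E]
  {M : Type*} [TopologicalSpace M] [ChartedSpace E M] [IsManifold 𝓘(ℝ, E) ∞ M]
  {E' : Type*} [NormedAddCommGroup E'] [NormedSpace ℝ E'] [FiniteDimensional ℝ E']
  {N : Type*} [TopologicalSpace N] [ChartedSpace E' N] [IsManifold 𝓘(ℝ, E') ∞ N]

/-- The projection of the derivative of the horizontal lift of `Y` along horizontal vectors. -/
def projectedCov (J : EndField E M) (g : BilinField E M) (D : Connection E M) (ξ : VField E M)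
    (p : M → N) (x : M) (Y : VField E' N) :
    TangentSpace 𝓘(ℝ, E') (p x) →L[ℝ] TangentSpace 𝓘(ℝ, E') (p x) :=
  (mfderiv 𝓘(ℝ, E) 𝓘(ℝ, E') p x).comp ((D (liftField J g ξ p Y) x).comp (lift J g ξ p x))

omit [FiniteDimensional ℝ E] [FiniteDimensional ℝ E'] [IsManifold 𝓘(ℝ, E') ∞ N] in
theorem projectedCov_apply (J : EndField E M) (g : BilinField E M) (D : Connection E M)
    (ξ : VField E M) (p : M → N) (x : M) (Y : VField E' N) (a : TangentSpace 𝓘(ℝ, E') (p x)) :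
    projectedCov J g D ξ p x Y a = mfderiv 𝓘(ℝ, E) 𝓘(ℝ, E') p x
      (D (liftField J g ξ p Y) x (lift J g ξ p x a)) := rfl

namespace ConicalSubmersion

variable {ε : ℝ} {J : EndField E M} {g : BilinField E M} {D : Connection E M} {ξ : VField E M}
  {p : M → N} {J' : EndField E' N} (h : ConicalSubmersion ε J g D ξ p J')
include h

theorem projectedCov_add {x : M} {Y Z : VField E' N} (hY : DiffVFieldAt Y (p x))
    (hZ : DiffVFieldAt Z (p x)) : projectedCov J g D ξ p x (Y + Z) =
      projectedCov J g D ξ p x Y + projectedCov J g D ξ p x Z := by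
  have e : liftField J g ξ p (Y + Z) = liftField J g ξ p Y + liftField J g ξ p Z :=
    funext fun y ↦ map_add _ _ _
  ext a
  rw [add_apply, projectedCov_apply, e, D.isCovariantDerivativeOnUniv.add
    (h.diffVFieldAt_liftField hY) (h.diffVFieldAt_liftField hZ), add_apply, map_add]
  rfl

theorem projectedCov_smul {x : M} {Y : VField E' N} {f : N → ℝ} (hY : DiffVFieldAt Y (p x))
    (hf : MDifferentiableAt 𝓘(ℝ, E') 𝓘(ℝ, ℝ) f (p x)) : projectedCov J g D ξ p x (f • Y) =
      f (p x) • projectedCov J g D ξ p x Y + (mvfderiv 𝓘(ℝ, E') f (p x)).smulRight (Y (p x)) := by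
  have e : liftField J g ξ p (f • Y) = (f ∘ p) • liftField J g ξ p Y :=
    funext fun y ↦ map_smul _ _ _
  ext a
  rw [add_apply, projectedCov_apply, e, D.isCovariantDerivativeOnUniv.leibniz
    (h.diffVFieldAt_liftField hY) (hf.comp x (h.mdifferentiableAt x)), add_apply, map_add,
    smul_apply, map_smul, ContinuousLinearMap.smulRight_apply, map_smul,
    mvfderiv_comp_apply_eq hf (h.mdifferentiableAt x), h.mfderiv_lift, liftField, h.mfderiv_lift]
  rfl

/-- The bracket of lifts may have a vertical part, which `dp` removes. -/
theorem projectedCov_sub {x : M} {Y Z : VField E' N} (hY : DiffVFieldAt Y (p x))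
    (hZ : DiffVFieldAt Z (p x)) :
    projectedCov J g D ξ p x Z (Y (p x)) - projectedCov J g D ξ p x Y (Z (p x)) =
      mlieBracket 𝓘(ℝ, E') Y Z (p x) := by
  have hLY := h.diffVFieldAt_liftField hY
  have hLZ := h.diffVFieldAt_liftField hZ
  rw [← mfderiv_mlieBracket_of_related h.holomorphic.smooth hLY hLZ hY hZ
    (fun y ↦ h.mfderiv_lift y _) (fun y ↦ h.mfderiv_lift y _),
    ← h.leviCivita.sub_eq_mlieBracket hLY hLZ, map_sub]
  rfl

theorem projectedCov_end {x : M} {Y : VField E' N}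
    (hY : DiffVFieldAt Y (p x)) (a : TangentSpace 𝓘(ℝ, E') (p x)) :
    projectedCov J g D ξ p x (fun y ↦ J' y (Y y)) a = J' (p x) (projectedCov J g D ξ p x Y a) := by
  have e : liftField J g ξ p (fun y ↦ J' y (Y y)) = fun x ↦ J x (liftField J g ξ p Y x) :=
    funext fun y ↦ (h.end_lift y _).symm
  rw [projectedCov_apply, e, h.parallel.covariantDerivative_apply (h.diffVFieldAt_liftField hY),
    h.holomorphic.comm]
  rfl

variable {g' : BilinField E' N} (hg' : ∀ x, g' (p x) = fibreForm J g ξ p x)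
include hg'

/-- Differentiate along a horizontal lift: `g(ξ, ξ)` is stationary in that direction, and pairing
with lifts sees only the horizontal part of each covariant derivative. -/
theorem mvfderiv_quotient (hgp : IsPseudoRiemannian g') {x : M} {Y Z : VField E' N}
    (hY : DiffVFieldAt Y (p x)) (hZ : DiffVFieldAt Z (p x)) (a : TangentSpace 𝓘(ℝ, E') (p x)) :
    mvfderiv 𝓘(ℝ, E') (fun y ↦ g' y (Y y) (Z y)) (p x) a =
      g' (p x) (projectedCov J g D ξ p x Y a) (Z (p x)) +
        g' (p x) (Y (p x)) (projectedCov J g D ξ p x Z a) := by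
  have hf := h.ne_zero x
  have e : (fun y ↦ g' y (Y y) (Z y)) ∘ p = fun y ↦ fibreForm J g ξ p y (Y (p y)) (Z (p y)) :=
    funext fun y ↦ by rw [Function.comp_apply, hg']
  have h1 := mvfderiv_comp_apply_eq (hgp.smooth.mdifferentiableAt_apply hY hZ)
    (h.mdifferentiableAt x) (lift J g ξ p x a)
  have h2 := h.mvfderiv_fibreForm hY hZ (lift J g ξ p x a)
  rw [← e, h1, h.mfderiv_lift, h.metric_lift_field, mul_zero, zero_mul, sub_zero] at h2
  have h3 := h.metric_lift_mfderiv x (Z (p x)) (D (liftField J g ξ p Y) x (lift J g ξ p x a))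
  have h4 := h.metric_lift_mfderiv x (Y (p x)) (D (liftField J g ξ p Z) x (lift J g ξ p x a))
  rw [h.metric.symm x (D _ x _), ← h3, ← h4] at h2
  rw [hgp.symm _ _ (Z (p x)), quotient_apply hg', quotient_apply hg', projectedCov_apply,
    projectedCov_apply, ← mul_add, ← h2, inv_mul_cancel_left₀ hf]

variable (hs : Function.Surjective p)
include hs

theorem isEpsKahler_quotient : IsEpsKahler ε J' g' := by
  have hgp := h.isPseudoRiemannian_quotient hg' hs
  -- Over each `y` one preimage is chosen, the same for all fields. Every condition on the
  -- connection is checked at one point of `N`, so independence of the preimage is not needed.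
  have H (y : N) : ∃ c : VField E' N → TangentSpace 𝓘(ℝ, E') y →L[ℝ] TangentSpace 𝓘(ℝ, E') y,
      ∃ x, ∃ hx : p x = y, c = hx ▸ projectedCov J g D ξ p x := by
    obtain ⟨x, rfl⟩ := hs y
    exact ⟨_, x, rfl, rfl⟩
  choose c hc using H
  let D' : Connection E' N :=
    { toFun := fun Y y ↦ c y Y
      isCovariantDerivativeOnUniv :=
        { add := fun {Y Z y} hY hZ _ ↦ by
            obtain ⟨x, rfl, hcx⟩ := hc y
            rw [hcx]
            exact h.projectedCov_add hY hZ
          leibniz := fun {Y f y} hY hf _ ↦ by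
            obtain ⟨x, rfl, hcx⟩ := hc y
            rw [hcx]
            exact h.projectedCov_smul hY hf } }
  have hD' (Y : VField E' N) (y : N) : D' Y y = c y Y := rfl
  refine ⟨hgp, h.smooth_end', h.sq', h.skew_quotient hg' hs, D', ⟨?_, ?_⟩, ?_⟩
  · refine D'.torsion_eq_zero_iff.2 fun {Y Z y} hY hZ ↦ ?_
    obtain ⟨x, rfl, hcx⟩ := hc y
    rw [hD', hD', hcx]
    exact h.projectedCov_sub hY hZ
  · intro y Y Z hY hZ a
    obtain ⟨x, rfl, hcx⟩ := hc y
    rw [covBilin, hD', hD', hcx, sub_sub, sub_eq_zero]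
    exact h.mvfderiv_quotient hg' hgp hY hZ a
  · intro y Y hY a
    obtain ⟨x, rfl, hcx⟩ := hc y
    rw [covEnd, hD', hD', hcx, sub_eq_zero]
    exact h.projectedCov_end hY a

end ConicalSubmersion

end QuotientConnection

/-! ### Application to the leaf projection -/

theorem leafProj_eq_iff {E : Type*} [NormedAddCommGroup E] [NormedSpace ℝ E]
    {M : Type*} [TopologicalSpace M] [ChartedSpace E M] {J : EndField E M} {ξ : VField E M}
    {x y : M} :
    leafProj J ξ x = leafProj J ξ y ↔ Relation.EqvGen (JoinedByTangentCurve J ξ) x y :=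
  Quotient.eq

theorem leafProj_eq_of_joined {E : Type*} [NormedAddCommGroup E] [NormedSpace ℝ E]
    {M : Type*} [TopologicalSpace M] [ChartedSpace E M] {J : EndField E M} {ξ : VField E M}
    (x y : M) (h : JoinedByTangentCurve J ξ x y) : leafProj J ξ x = leafProj J ξ y :=
  leafProj_eq_iff.2 (Relation.EqvGen.rel _ _ h)

theorem IsConicalSpecial.conicalSubmersion {n : ℕ} {ε : ℝ} (hε : ε = -1 ∨ ε = 1)
    {M : Type*} [TopologicalSpace M]
    [ChartedSpace (EuclideanSpace ℝ (Fin (2 * n + 2))) M]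
    [IsManifold 𝓘(ℝ, EuclideanSpace ℝ (Fin (2 * n + 2))) ∞ M]
    {J : EndField (EuclideanSpace ℝ (Fin (2 * n + 2))) M}
    {g : BilinField (EuclideanSpace ℝ (Fin (2 * n + 2))) M}
    {nabla : Connection (EuclideanSpace ℝ (Fin (2 * n + 2))) M}
    {ξ : VField (EuclideanSpace ℝ (Fin (2 * n + 2))) M}
    (hM : IsConicalSpecial ε J g nabla ξ)
    [ChartedSpace (EuclideanSpace ℝ (Fin (2 * n))) (LeafSpace J ξ)]
    [IsManifold 𝓘(ℝ, EuclideanSpace ℝ (Fin (2 * n))) ∞ (LeafSpace J ξ)]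
    {J' : EndField (EuclideanSpace ℝ (Fin (2 * n))) (LeafSpace J ξ)}
    (hreg : IsRegular ε J g ξ J') :
    ∃ D, ConicalSubmersion ε J g D ξ (leafProj J ξ) J' := by
  obtain ⟨D, hD, hDξ⟩ := hM.leviCivita_xi
  have hk := hM.special.kahler
  obtain ⟨D₀, hD₀, hJ⟩ := hk.parallel
  exact ⟨D,
    { eps_mul_eps := by rcases hε with rfl | rfl <;> norm_num
      metric := hk.metric
      smooth_end := hk.smooth
      sq := hk.sq
      skew := hk.skew
      leviCivita := hD
      -- The connections with `Dξ = Id` and with `DJ = 0` are given separately; uniqueness of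
      -- Levi-Civita identifies them on differentiable fields.
      parallel := fun x Y hY v ↦ by
        rw [covEnd, hD.eq_of_diffVFieldAt hk.metric hD₀ hY,
          hD.eq_of_diffVFieldAt hk.metric hD₀ (hk.smooth.diffVFieldAt_apply hY)]
        exact hJ x Y hY v
      smooth_field := hM.smooth
      cov_field := hDξ
      ne_zero := hreg.ne_zero
      holomorphic := hreg.holomorphic
      smooth_end' := hreg.complex.smooth
      sq' := hreg.complex.sq
      exists_section := exists_local_section hreg.submersion
      mfderiv_field := mfderiv_eq_zero_of_mem_leafDist leafProj_eq_of_joined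
        hreg.holomorphic.smooth hM.smooth fun x ↦ Submodule.subset_span (mem_insert _ _)
      finrank_eq := by simp }⟩

end EpsKahler

end

open EpsKahler in
theorem mainTheorem5 (n : ℕ) (ε : ℝ) (hε : ε = -1 ∨ ε = 1)
    {M : Type*} [TopologicalSpace M] [T2Space M]
    [ChartedSpace (EuclideanSpace ℝ (Fin (2 * n + 2))) M]
    [IsManifold 𝓘(ℝ, EuclideanSpace ℝ (Fin (2 * n + 2))) ∞ M]
    (J : EndField (EuclideanSpace ℝ (Fin (2 * n + 2))) M)
    (g : BilinField (EuclideanSpace ℝ (Fin (2 * n + 2))) M)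
    (nabla : Connection (EuclideanSpace ℝ (Fin (2 * n + 2))) M)
    (ξ : VField (EuclideanSpace ℝ (Fin (2 * n + 2))) M)
    (hM : IsConicalSpecial ε J g nabla ξ)
    [ChartedSpace (EuclideanSpace ℝ (Fin (2 * n))) (LeafSpace J ξ)]
    [IsManifold 𝓘(ℝ, EuclideanSpace ℝ (Fin (2 * n))) ∞ (LeafSpace J ξ)]
    (J' : EndField (EuclideanSpace ℝ (Fin (2 * n))) (LeafSpace J ξ))
    (hreg : IsRegular ε J g ξ J') :
    ∃ g' : BilinField (EuclideanSpace ℝ (Fin (2 * n))) (LeafSpace J ξ),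
      IsEpsKahler ε J' g' ∧
      PullbackEq (leafProj J ξ) g' (hTensor ε J g ξ) ∧
      ∀ g'' : BilinField (EuclideanSpace ℝ (Fin (2 * n))) (LeafSpace J ξ),
        PullbackEq (leafProj J ξ) g'' (hTensor ε J g ξ) → g'' = g' := by
  obtain ⟨D, h⟩ := hM.conicalSubmersion hε hreg
  have hs : Function.Surjective (leafProj J ξ) := Quotient.mk_surjective
  obtain ⟨g', hg'⟩ := h.exists_bilinField_eq_fibreForm leafProj_eq_of_joined
    (fun _ _ ↦ leafProj_eq_iff.1) hs
  exact ⟨g', h.isEpsKahler_quotient hg' hs, h.pullbackEq_quotient hg',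
    fun _ hg'' ↦ h.eq_quotient hg' hs hg''⟩
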